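/- **Setting.** A *prefix machine* is a partial computable function $M:\{0,1\}^*\rightharpoonup\{0,1\}^*$ whose domain is prefix-free. Fix a *universal* prefix machine $U$, i.e. a prefix machine such that for every prefix machine $M$ there is a constant $c$ such that whenever $M(\pi)=w$ there is $\rho$ with $|\rho|\le|\pi|+c$ and $U(\rho)=w$. Let $K(w)=\min\{|\pi| : U(\pi)=w\}$, and extend $K$ to rational points $q\in\mathbb{Q}^n$ by a standard binary encoding of $\mathbb{Q}^n$. For $x\in\mathbb{R}^n$ and $r\in\mathbb{N}$ let $$K_r(x)=\min\{K(q) : q\in\mathbb{Q}^n,\ |q-x|<2^{-r}\},$$ $$\dim(x)=\liminf_{r\to\infty}\frac{K_r(x)}{r},\qquad \mathrm{Dim}(x)=\limsup_{r\to\infty}\frac{K_r(x)}{r}.$$ For a finite outer measure $\mu$ on $\mathbb{R}^n$, the lower and upper local dimensions of $\mu$ at $x$ are $$(\dim_{\mathrm{loc}}\mu)(x)=\liminf_{r\to\infty}\frac{\log_2\frac{1}{\mu(B(x,2^{-r}))}}{r},\qquad (\mathrm{Dim}_{\mathrm{loc}}\,\mu)(x)=\limsup_{r\to\infty}\frac{\log_2\frac{1}{\mu(B(x,2^{-r}))}}{r},$$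 where $B(x,\varepsilon)$ is the open Euclidean ball of radius $\varepsilon$ about $x$. An outer measure $\mu$ on $\mathbb{R}^n$ is - *strongly finite* if $\mu(\mathbb{R}^n\setminus\mathbb{Q}^n)=0$ and $\sum_{q\in\mathbb{Q}^n}\mu(\{q\})<\infty$; - *lower semicomputable* if (a) for every $\varepsilon>0$ there is a finite $A\subseteq\mathbb{Q}^n$ with $\mu(\mathbb{R}^n\setminus A)<\varepsilon$, and (b) there is a computable function $\hat\mu$ taking a finite set $A\subseteq\mathbb{Q}^n$ and $t\in\mathbb{N}$ to $\hat\mu(A,t)\in\mathbb{Q}\cap[0,\infty)$ such that $\hat\mu(A,s)\le\hat\mu(A,t)\le\mu(A)$ whenever $s\le t$, and $\lim_{t\to\infty}\hat\mu(A,t)=\mu(A)$, for every finite $A\subseteq\mathbb{Q}^n$; - *locally optimal* if $\mu$ is strongly finite and lower semicomputable and, for every strongly finite, lower semicomputable outer measure $\nu$ on $\mathbb{R}^n$, there is a function $\beta:\mathbb{N}\to(0,\infty)$ with $\beta(r)=2^{-o(r)}$ as $r\to\infty$ such that, for every $r\in\mathbb{N}$ and every $r$-dyadic cube $Q=\prod_{i=1}^n[2^{-r}m_i,2^{-r}(m_i+1))$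 with $m\in\mathbb{Z}^n$, $$\mu(Q)\ge\beta(r)\,\nu(Q).$$ **Theorem.** If $\mu$ is any locally optimal outer measure on $\mathbb{R}^n$, then for all $x\in\mathbb{R}^n$, $$(\dim_{\mathrm{loc}}\mu)(x)=\dim(x)\qquad\text{and}\qquad(\mathrm{Dim}_{\mathrm{loc}}\,\mu)(x)=\mathrm{Dim}(x).$$ -/

import Mathlib

open Filter Topology MeasureTheory Asymptotics
open scoped NNReal ENNReal

noncomputable section

namespace AlgDim

/-! ### Prefix machines and Kolmogorov complexity -/

/-- A prefix machine: a partial computable function on binary strings whose domain is prefix-free. -/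
structure IsPrefixMachine (M : List Bool →. List Bool) : Prop where
  partrec : Partrec M
  prefixFree : ∀ π ρ : List Bool, (M π).Dom → (M ρ).Dom → π <+: ρ → π = ρ

/-- A universal prefix machine: a prefix machine that simulates every prefix machine with at most a
constant increase of the program length. (Machines that simulate through a fixed program prefix for
each `M` are a special case.) -/
structure IsUniversalPrefixMachine (U : List Bool →. List Bool) : Prop where
  isPrefixMachine : IsPrefixMachine U
  universal : ∀ M : List Bool →. List Bool, IsPrefixMachine M →
    ∃ c : ℕ, ∀ π w : List Bool, w ∈ M π → ∃ ρ : List Bool, ρ.length ≤ π.length + c ∧ w ∈ U ρ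

/-- Prefix Kolmogorov complexity of a string: the least length of a `U`-program for it. When `U` is
universal, every string has a program, so the minimum is over a nonempty set. -/
def complexity (U : List Bool →. List Bool) (w : List Bool) : ℕ :=
  sInf {k : ℕ | ∃ π : List Bool, w ∈ U π ∧ k = π.length}

/-- The standard code of a rational number: numerator and denominator in lowest terms. -/
def ratCode (q : ℚ) : ℤ × ℕ := (q.num, q.den)

/-- The code of a rational point: the tuple of the codes of its coordinates. -/
def pointCode {n : ℕ} (q : Fin n → ℚ) : Fin n → ℤ × ℕ := fun i => ratCode (q i)

/-- The binary string that encodes an element: the binary digits of its number in the (computable)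
numbering of the type. -/
def binaryString {α : Type*} [Primcodable α] (a : α) : List Bool := Nat.bits (Encodable.encode a)

/-- The binary string that encodes a rational point. -/
def pointString {n : ℕ} (q : Fin n → ℚ) : List Bool := binaryString (pointCode q)

/-- Kolmogorov complexity `K(q)` of a rational point. -/
def pointComplexity (U : List Bool →. List Bool) {n : ℕ} (q : Fin n → ℚ) : ℕ :=
  complexity U (pointString q)

/-- The rational point `q`, regarded as a point of Euclidean space. -/
def ratPoint {n : ℕ} (q : Fin n → ℚ) : EuclideanSpace ℝ (Fin n) :=
  WithLp.toLp 2 fun i => (q i : ℝ)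

/-- `K_r(x)`: the least complexity of a rational point at distance less than `2^{-r}` from `x`. -/
def complexityAt (U : List Bool →. List Bool) {n : ℕ} (r : ℕ) (x : EuclideanSpace ℝ (Fin n)) : ℕ :=
  sInf {k : ℕ | ∃ q : Fin n → ℚ, dist (ratPoint q) x < ((2 : ℝ) ^ r)⁻¹ ∧ k = pointComplexity U q}

/-- Algorithmic dimension `dim(x)`. -/
def algDim (U : List Bool →. List Bool) {n : ℕ} (x : EuclideanSpace ℝ (Fin n)) : EReal :=
  liminf (fun r : ℕ => (((complexityAt U r x : ℝ) / (r : ℝ) : ℝ) : EReal)) atTop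

/-- Strong algorithmic dimension `Dim(x)`. -/
def strongAlgDim (U : List Bool →. List Bool) {n : ℕ} (x : EuclideanSpace ℝ (Fin n)) : EReal :=
  limsup (fun r : ℕ => (((complexityAt U r x : ℝ) / (r : ℝ) : ℝ) : EReal)) atTop

/-! ### Local dimensions of outer measures -/

/-- `log₂ (1 / a)` for `a ∈ [0, ∞]`, with value `∞` at `a = 0`. -/
def negLogTwo (a : ℝ≥0∞) : EReal := ENNReal.log a⁻¹ / ((Real.log 2 : ℝ) : EReal)

/-- Lower local dimension of `μ` at `x`. -/
def lowerLocalDim {n : ℕ} (μ : OuterMeasure (EuclideanSpace ℝ (Fin n)))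
    (x : EuclideanSpace ℝ (Fin n)) : EReal :=
  liminf (fun r : ℕ => negLogTwo (μ (Metric.ball x ((2 : ℝ) ^ r)⁻¹)) / ((r : ℝ) : EReal)) atTop

/-- Upper local dimension of `μ` at `x`. -/
def upperLocalDim {n : ℕ} (μ : OuterMeasure (EuclideanSpace ℝ (Fin n)))
    (x : EuclideanSpace ℝ (Fin n)) : EReal :=
  limsup (fun r : ℕ => negLogTwo (μ (Metric.ball x ((2 : ℝ) ^ r)⁻¹)) / ((r : ℝ) : EReal)) atTop

/-! ### Strongly finite and lower semicomputable outer measures -/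

/-- `μ` is finitely supported on the rational points. -/
def FinitelySupported {n : ℕ} (μ : OuterMeasure (EuclideanSpace ℝ (Fin n))) : Prop :=
  ∀ ε : ℝ≥0∞, 0 < ε → ∃ A : Finset (Fin n → ℚ), μ (ratPoint '' (A : Set (Fin n → ℚ)))ᶜ < ε

/-- `μ` is supported on the rational points and the masses of the rational points have finite sum. -/
def StronglyFinite {n : ℕ} (μ : OuterMeasure (EuclideanSpace ℝ (Fin n))) : Prop :=
  μ (Set.range (ratPoint (n := n)))ᶜ = 0 ∧ ∑' q : Fin n → ℚ, μ {ratPoint q} < ∞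

/-- Computability of a function on finite sets of rational points and natural numbers, with rational
values: an algorithm computes the code of the value from any list of the codes of the points of the
set (in any order, repetitions allowed) and the number. -/
def ComputableApprox {n : ℕ} (f : Finset (Fin n → ℚ) → ℕ → ℚ≥0) : Prop :=
  ∃ F : List (Fin n → ℤ × ℕ) → ℕ → ℤ × ℕ, Computable₂ F ∧
    ∀ (l : List (Fin n → ℚ)) (t : ℕ), F (l.map pointCode) t = ratCode (f l.toFinset t : ℚ)

/-- Lower semicomputable outer measures. -/
def LowerSemicomputable {n : ℕ} (μ : OuterMeasure (EuclideanSpace ℝ (Fin n))) : Prop :=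
  FinitelySupported μ ∧
  ∃ f : Finset (Fin n → ℚ) → ℕ → ℚ≥0, ComputableApprox f ∧
    (∀ (A : Finset (Fin n → ℚ)) (s t : ℕ), s ≤ t →
      f A s ≤ f A t ∧ (((f A t : ℝ≥0) : ℝ≥0∞) ≤ μ (ratPoint '' (A : Set (Fin n → ℚ))))) ∧
    ∀ A : Finset (Fin n → ℚ),
      Tendsto (fun t : ℕ => ((f A t : ℝ≥0) : ℝ≥0∞)) atTop
        (𝓝 (μ (ratPoint '' (A : Set (Fin n → ℚ)))))

/-! ### Local optimality -/

/-- The `r`-dyadic cube with address `m`. -/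
def dyadicCube {n : ℕ} (r : ℕ) (m : Fin n → ℤ) : Set (EuclideanSpace ℝ (Fin n)) :=
  {x | ∀ i, (m i : ℝ) / 2 ^ r ≤ x i ∧ x i < ((m i : ℝ) + 1) / 2 ^ r}

/-- `μ` dominates `ν` on the families `𝒜 r`: `μ E ≥ β r * ν E` for all `E ∈ 𝒜 r`, where
`β r = 2^{-o(r)}`, that is, `β r > 0` and `log₂ (β r) = o(r)`. -/
def DominatesOn {n : ℕ} (μ ν : OuterMeasure (EuclideanSpace ℝ (Fin n)))
    (𝒜 : ℕ → Set (Set (EuclideanSpace ℝ (Fin n)))) : Prop :=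
  ∃ β : ℕ → ℝ, (∀ r, 0 < β r) ∧
    (fun r : ℕ => Real.logb 2 (β r)) =o[atTop] (fun r : ℕ => (r : ℝ)) ∧
    ∀ r : ℕ, ∀ E ∈ 𝒜 r, ENNReal.ofReal (β r) * ν E ≤ μ E

/-- `μ` dominates `ν` on dyadic cubes. -/
def DominatesOnDyadicCubes {n : ℕ} (μ ν : OuterMeasure (EuclideanSpace ℝ (Fin n))) : Prop :=
  DominatesOn μ ν fun r => Set.range (dyadicCube r)

/-- Locally optimal outer measures. -/
structure LocallyOptimal {n : ℕ} (μ : OuterMeasure (EuclideanSpace ℝ (Fin n))) : Prop where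
  stronglyFinite : StronglyFinite μ
  lowerSemicomputable : LowerSemicomputable μ
  dominates : ∀ ν : OuterMeasure (EuclideanSpace ℝ (Fin n)),
    StronglyFinite ν → LowerSemicomputable ν → DominatesOnDyadicCubes μ ν

end AlgDim

end

/-!
Let `μ` be locally optimal and let `U` be the universal machine.

The semimeasure that gives each rational point `q` the total mass `∑ 2^{-|π|}` of the programs `π`
for `q` is strongly finite by the Kraft inequality and lower semicomputable by enumerating programs,
so `μ` dominates it on dyadic cubes. A shortest program for a rational point close to `x` puts mass
`2^{-K_{r+1}(x)}` on a small dyadic cube inside `B(x, 2^{-r})`, hence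
`log₂ (1 / μ (B(x, 2^{-r}))) ≤ K_{r+1}(x) + o(r)`.

Conversely, at most `2^{s + O(1)}` dyadic cubes of level `r` have `μ`-mass above `2^{-s}`, and these
cubes can be enumerated uniformly in `r` and `s`. The position in this enumeration, preceded by a
self-delimiting description of `(r, s)`, is a program of length `s + O(log (r + s))` for a corner of
such a cube. A ball of radius `2^{-r}` is covered by `3^n` cubes of level `r`, so one of them has at
least `3^{-n}` times the mass of the ball, and its corner is a rational point of small complexity
close to `x`.
-/

noncomputable section

namespace AlgDim

/-! ### Primitive recursive arithmetic -/

theorem primrec_nat_pow : Primrec₂ ((· ^ ·) : ℕ → ℕ → ℕ) :=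
  Primrec₂.unpaired'.1 Nat.Primrec.pow

theorem primrec_nat_testBit : Primrec₂ Nat.testBit := by
  have h : PrimrecRel fun a i : ℕ => a / 2 ^ i % 2 = 1 :=
    Primrec.eq.comp
      (Primrec.nat_mod.comp
        (Primrec.nat_div.comp Primrec.fst
          (primrec_nat_pow.comp (Primrec.const 2) Primrec.snd))
        (Primrec.const 2))
      (Primrec.const 1)
  exact h.decide.of_eq fun a i => Nat.testBit_eq_decide_div_mod_eq.symm

theorem primrec_nat_gcd : Primrec₂ Nat.gcd := by
  have hdvd : PrimrecRel fun (p : ℕ × ℕ) (d : ℕ) => p.1 % d = 0 ∧ p.2 % d = 0 :=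
    PrimrecPred.and
      (Primrec.eq.comp (Primrec.nat_mod.comp (Primrec.fst.comp Primrec.fst) Primrec.snd)
        (Primrec.const 0))
      (Primrec.eq.comp (Primrec.nat_mod.comp (Primrec.snd.comp Primrec.fst) Primrec.snd)
        (Primrec.const 0))
  have hgreatest := Primrec.nat_findGreatest (f := fun p : ℕ × ℕ => p.1 + p.2)
    (Primrec.nat_add.comp Primrec.fst Primrec.snd) hdvd
  refine Primrec.of_eq hgreatest fun ⟨a, b⟩ => ?_
  rw [Nat.findGreatest_eq_iff]
  refine ⟨?_, fun _ => ⟨Nat.mod_eq_zero_of_dvd (Nat.gcd_dvd_left a b),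
    Nat.mod_eq_zero_of_dvd (Nat.gcd_dvd_right a b)⟩, fun d hgcd hd h => ?_⟩
  · rcases Nat.eq_zero_or_pos a with rfl | ha
    · simp
    · exact (Nat.gcd_le_left b ha).trans (Nat.le_add_right _ _)
  · have hdvd := Nat.dvd_gcd (Nat.dvd_of_mod_eq_zero h.1) (Nat.dvd_of_mod_eq_zero h.2)
    rcases Nat.eq_zero_or_pos (a.gcd b) with hzero | hpos
    · rw [Nat.gcd_eq_zero_iff] at hzero
      simp only at hd
      omega
    · exact absurd (Nat.le_of_dvd hpos hdvd) hgcd.not_ge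

theorem encode_int_natCast (k : ℕ) : Encodable.encode (k : ℤ) = 2 * k := rfl

theorem encode_int_negSucc (k : ℕ) : Encodable.encode (Int.negSucc k) = 2 * k + 1 := rfl

theorem primrec_int_toNat : Primrec Int.toNat := by
  have h : Primrec fun z : ℤ =>
      if Encodable.encode z % 2 = 0 then Encodable.encode z / 2 else 0 :=
    Primrec.ite (Primrec.eq.comp (Primrec.nat_mod.comp Primrec.encode (Primrec.const 2))
      (Primrec.const 0)) (Primrec.nat_div.comp Primrec.encode (Primrec.const 2)) (Primrec.const 0)
  refine h.of_eq fun z => ?_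
  cases z with
  | ofNat k => simp [encode_int_natCast]
  | negSucc k => rw [encode_int_negSucc, if_neg (by omega), Int.toNat_negSucc]

theorem primrec_int_neg_toNat : Primrec fun z : ℤ => (-z).toNat := by
  have h : Primrec fun z : ℤ =>
      if Encodable.encode z % 2 = 0 then 0 else Encodable.encode z / 2 + 1 :=
    Primrec.ite (Primrec.eq.comp (Primrec.nat_mod.comp Primrec.encode (Primrec.const 2))
      (Primrec.const 0)) (Primrec.const 0)
      (Primrec.succ.comp (Primrec.nat_div.comp Primrec.encode (Primrec.const 2)))
  refine h.of_eq fun z => ?_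
  cases z with
  | ofNat k => simp [encode_int_natCast]
  | negSucc k =>
    rw [encode_int_negSucc, if_neg (by omega)]
    omega

theorem primrec_int_subNat : Primrec₂ fun p q : ℕ => (p : ℤ) - (q : ℤ) := by
  rw [← Primrec₂.encode_iff]
  have h : Primrec₂ fun p q : ℕ => if q ≤ p then 2 * (p - q) else 2 * (q - p - 1) + 1 :=
    Primrec.ite (Primrec.nat_le.comp Primrec.snd Primrec.fst)
      (Primrec.nat_double.comp (Primrec.nat_sub.comp Primrec.fst Primrec.snd))
      (Primrec.nat_double_succ.comp
        (Primrec.nat_sub.comp (Primrec.nat_sub.comp Primrec.snd Primrec.fst) (Primrec.const 1)))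
  refine h.of_eq fun p q => ?_
  split_ifs with hqp
  · rw [← Nat.cast_sub hqp, encode_int_natCast]
  · have hneg : (p : ℤ) - q = Int.negSucc (q - p - 1) := by omega
    rw [hneg, encode_int_negSucc]

theorem primrec_int_mul : Primrec₂ ((· * ·) : ℤ → ℤ → ℤ) := by
  have hx := primrec_int_toNat.comp (Primrec.fst (α := ℤ) (β := ℤ))
  have hx' := primrec_int_neg_toNat.comp (Primrec.fst (α := ℤ) (β := ℤ))
  have hy := primrec_int_toNat.comp (Primrec.snd (α := ℤ) (β := ℤ))
  have hy' := primrec_int_neg_toNat.comp (Primrec.snd (α := ℤ) (β := ℤ))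
  refine Primrec.of_eq (primrec_int_subNat.comp
    (Primrec.nat_add.comp (Primrec.nat_mul.comp hx hy) (Primrec.nat_mul.comp hx' hy'))
    (Primrec.nat_add.comp (Primrec.nat_mul.comp hx hy') (Primrec.nat_mul.comp hx' hy)))
    fun ⟨x, y⟩ => ?_
  push_cast
  conv_rhs => rw [← Int.toNat_sub_toNat_neg x, ← Int.toNat_sub_toNat_neg y]
  ring

theorem primrec_int_natCast : Primrec fun k : ℕ => (k : ℤ) :=
  (primrec_int_subNat.comp Primrec.id (Primrec.const 0)).of_eq fun k => by simp

theorem primrec_int_succ : Primrec fun z : ℤ => z + 1 :=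
  (primrec_int_subNat.comp (Primrec.succ.comp primrec_int_toNat) primrec_int_neg_toNat).of_eq
    fun z => by omega

theorem primrec_int_le : PrimrecRel ((· ≤ ·) : ℤ → ℤ → Prop) := by
  have h := Primrec.nat_le.comp
    (Primrec.nat_add.comp (primrec_int_toNat.comp (Primrec.fst (α := ℤ) (β := ℤ)))
      (primrec_int_neg_toNat.comp (Primrec.snd (α := ℤ) (β := ℤ))))
    (Primrec.nat_add.comp (primrec_int_toNat.comp (Primrec.snd (α := ℤ) (β := ℤ)))
      (primrec_int_neg_toNat.comp (Primrec.fst (α := ℤ) (β := ℤ))))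
  exact PrimrecPred.of_eq h fun ⟨x, y⟩ => by
    simp only
    omega

theorem primrec_int_lt : PrimrecRel ((· < ·) : ℤ → ℤ → Prop) :=
  (primrec_int_le.swap.not).of_eq fun x y => by simp [Function.swap]

theorem primrec_list_replicate {α : Type*} [Primcodable α] (a : α) :
    Primrec fun k : ℕ => List.replicate k a :=
  (Primrec.list_map Primrec.list_range (g := fun _ _ => a) (Primrec₂.const a)).of_eq
    fun k => by simp

theorem primrecPred_forall_fin {α : Type*} [Primcodable α] {n : ℕ} {p : α → Fin n → Prop}
    (hp : ∀ i, PrimrecPred fun a => p a i) : PrimrecPred fun a => ∀ i, p a i := by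
  classical
  have hdecide : Primrec₂ fun (i : Fin n) (a : α) => decide (p a i) :=
    Primrec.fin_curry₁.2 fun i => (hp i).decide
  exact PrimrecPred.of_eq
    (hdecide.primrecRel.forall_mem_list.comp (Primrec.const (List.finRange n)) Primrec.id)
    fun a => by simp

/-! ### Binary strings -/

theorem bits_eq_bodd_cons {k : ℕ} (hk : k ≠ 0) : k.bits = k.bodd :: k.div2.bits := by
  have hne : k.bits ≠ [] := fun h => hk <| by
    rw [← Nat.size_eq_zero, ← Nat.size_eq_bits_len, h, List.length_nil]
  obtain ⟨b, l, hbl⟩ := List.exists_cons_of_ne_nil hne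
  rw [Nat.bodd_eq_bits_head, Nat.div2_bits_eq_tail, hbl, List.headI_cons, List.tail_cons]

theorem primrec_nat_bits : Primrec Nat.bits := by
  have hstep : Primrec₂ fun (_ : Unit) (l : List (List Bool)) =>
      if l.length = 0 then some [] else
        (l[l.length.div2]?).map fun b => l.length.bodd :: b := by
    have hlength : Primrec fun p : Unit × List (List Bool) => p.2.length :=
      Primrec.list_length.comp Primrec.snd
    exact Primrec.ite (Primrec.eq.comp hlength (Primrec.const 0)) (Primrec.const _)
      (Primrec.option_map
        (Primrec.list_getElem?.comp Primrec.snd (Primrec.nat_div2.comp hlength))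
        (Primrec.list_cons.comp (Primrec.nat_bodd.comp (hlength.comp Primrec.fst)) Primrec.snd))
  refine (Primrec.nat_strong_rec (fun (_ : Unit) (k : ℕ) => Nat.bits k) hstep
    fun _ k => ?_).comp (Primrec.const ()) Primrec.id
  rcases eq_or_ne k 0 with rfl | hk
  · simp
  · have hlt : k.div2 < k := by
      rw [Nat.div2_val]
      omega
    simp only [List.length_map, List.length_range, hk, if_false, List.getElem?_map,
      List.getElem?_range hlt, Option.map_some, bits_eq_bodd_cons hk]

theorem primrec_binaryString {α : Type*} [Primcodable α] : Primrec (binaryString (α := α)) :=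
  primrec_nat_bits.comp Primrec.encode

theorem bits_injective : Function.Injective Nat.bits := fun a b h =>
  Nat.eq_of_testBit_eq fun i => by rw [Nat.testBit_eq_inth, h, ← Nat.testBit_eq_inth]

theorem binaryString_injective {α : Type*} [Primcodable α] :
    Function.Injective (binaryString (α := α)) :=
  bits_injective.comp Encodable.encode_injective

theorem length_binaryString {α : Type*} [Primcodable α] (a : α) :
    (binaryString a).length = (Encodable.encode a).size :=
  Nat.size_eq_bits_len _

/-! ### Codes of rational points -/

theorem ratCode_injective : Function.Injective ratCode := fun _ _ h =>
  Rat.ext (congrArg Prod.fst h) (congrArg Prod.snd h)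

theorem pointCode_injective {n : ℕ} : Function.Injective (pointCode (n := n)) :=
  fun _ _ h => funext fun i => ratCode_injective (congrFun h i)

theorem pointString_injective {n : ℕ} : Function.Injective (pointString (n := n)) :=
  binaryString_injective.comp pointCode_injective

theorem ratPoint_injective {n : ℕ} : Function.Injective (ratPoint (n := n)) := fun _ _ h =>
  funext fun i => Rat.cast_injective (congrFun (congrArg WithLp.ofLp h) i)

theorem ratCode_mkRat (a : ℤ) {b : ℕ} (hb : b ≠ 0) :
    ratCode (mkRat a b) = (a / (a.natAbs.gcd b : ℕ), b / a.natAbs.gcd b) := by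
  simp [ratCode, mkRat, hb, Rat.normalize_eq]

theorem primrec_ratCode_mkRat : Primrec₂ fun (a : ℤ) (b : ℕ) => ratCode (mkRat a b) := by
  have ha := primrec_int_toNat.comp (Primrec.fst (α := ℤ) (β := ℕ))
  have ha' := primrec_int_neg_toNat.comp (Primrec.fst (α := ℤ) (β := ℕ))
  have hgcd := primrec_nat_gcd.comp (Primrec.nat_add.comp ha ha') (Primrec.snd (α := ℤ) (β := ℕ))
  have h := Primrec.ite (Primrec.eq.comp (Primrec.snd (α := ℤ) (β := ℕ)) (Primrec.const 0))
    (Primrec.const ((0, 1) : ℤ × ℕ))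
    (Primrec.pair (primrec_int_subNat.comp (Primrec.nat_div.comp ha hgcd)
      (Primrec.nat_div.comp ha' hgcd)) (Primrec.nat_div.comp Primrec.snd hgcd))
  refine Primrec.of_eq h fun ⟨a, b⟩ => ?_
  by_cases hb : b = 0
  · simp [hb, ratCode]
  have hnatAbs : a.toNat + (-a).toNat = a.natAbs := by omega
  simp only [hb, if_false, hnatAbs, ratCode_mkRat a hb, Prod.mk.injEq, and_true]
  obtain ⟨k, rfl | rfl⟩ := a.eq_nat_or_neg
  · simp
  · have hdvd : ((k.gcd b : ℕ) : ℤ) ∣ k := Int.natCast_dvd_natCast.2 (Nat.gcd_dvd_left k b)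
    simp [Int.neg_ediv_of_dvd hdvd]

/-- The rational point whose coordinates are the given, not necessarily reduced, fractions: a
left inverse of `pointCode` that is defined on all tuples of codes. -/
def fracPoint {n : ℕ} (c : Fin n → ℤ × ℕ) : Fin n → ℚ := fun i => mkRat (c i).1 (c i).2

theorem fracPoint_pointCode {n : ℕ} (q : Fin n → ℚ) : fracPoint (pointCode q) = q :=
  funext fun i => Rat.mkRat_self (q i)

theorem primrec_pointCode_fracPoint {n : ℕ} :
    Primrec fun c : Fin n → ℤ × ℕ => pointCode (fracPoint c) := by
  refine Primrec.fin_curry.2 ?_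
  have happ : Primrec₂ fun (c : Fin n → ℤ × ℕ) (i : Fin n) => c i := Primrec.fin_app
  exact primrec_ratCode_mkRat.comp (Primrec.fst.comp happ) (Primrec.snd.comp happ)

/-! ### Recursively enumerable predicates -/

theorem exists_primrecRel_of_rePred {α : Type*} [Primcodable α] {p : α → Prop} (hp : REPred p) :
    ∃ R : α → ℕ → Prop, PrimrecRel R ∧ (∀ a s t, s ≤ t → R a s → R a t) ∧
      ∀ a, p a ↔ ∃ t, R a t := by
  obtain ⟨c, hc⟩ := Nat.Partrec.Code.exists_code.1 hp
  refine ⟨fun a t => (c.evaln t (Encodable.encode a)).isSome, ?_, fun a s t hst hs => ?_,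
    fun a => ?_⟩
  · exact Primrec.eq.comp (Primrec.option_isSome.comp (Nat.Partrec.Code.primrec_evaln.comp
      (Primrec.pair (Primrec.pair Primrec.snd (Primrec.const c))
        (Primrec.encode.comp Primrec.fst)))) (Primrec.const true)
  · obtain ⟨y, hy⟩ := Option.isSome_iff_exists.1 hs
    exact Option.isSome_iff_exists.2 ⟨y, Nat.Partrec.Code.evaln_mono hst hy⟩
  · have heval : p a ↔ (c.eval (Encodable.encode a)).Dom := by
      rw [hc]
      simp [Part.assert]
    simp_rw [heval, Part.dom_iff_mem, Nat.Partrec.Code.evaln_complete, Option.isSome_iff_exists,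
      Option.mem_def]
    exact exists_comm

theorem rePred_exists {α β : Type*} [Primcodable α] [Primcodable β] {R : α → β → Prop}
    (hR : ComputablePred fun p : α × β => R p.1 p.2) : REPred fun a => ∃ b, R a b := by
  classical
  obtain ⟨test, htest, htest_iff⟩ :
      ∃ test : α × β → Bool, Computable test ∧ ∀ a b, test (a, b) = true ↔ R a b :=
    ⟨_, hR.decide, fun a b => decide_eq_true_iff⟩
  let search : α → ℕ → Option Unit := fun a k =>
    (Encodable.decode (α := β) k).bind fun b => bif test (a, b) then some () else none
  have hsearch : Computable₂ search :=
    Computable.option_bind (Computable.decode.comp Computable.snd) <|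
      Computable.cond (htest.comp
        (Computable.pair (Computable.fst.comp Computable.fst) Computable.snd))
        (Computable.const _) (Computable.const _)
  refine (Partrec.rfindOpt hsearch).dom_re.of_eq fun a => ?_
  simp only [Nat.rfindOpt_dom, search, Option.mem_def, Option.bind_eq_some_iff, ← htest_iff]
  constructor
  · rintro ⟨k, _, b, -, hb⟩
    exact ⟨b, by_contra fun hfalse => by simp [hfalse] at hb⟩
  · rintro ⟨b, hb⟩
    exact ⟨Encodable.encode b, (), b, Encodable.encodek b, by simp [hb]⟩

/-! ### The Kraft inequality for prefix-free sets -/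

theorem uniquelyDecodable_of_prefixFree {α : Type*} {S : Set (List α)} (hnil : [] ∉ S)
    (hS : ∀ π ∈ S, ∀ ρ ∈ S, π <+: ρ → π = ρ) : InformationTheory.UniquelyDecodable S := by
  have hne : ∀ v ∈ S, ∀ l : List α, v ++ l ≠ [] := fun v hv l h =>
    hnil ((List.append_eq_nil_iff.1 h).1 ▸ hv)
  intro L₁
  induction L₁ with
  | nil =>
    rintro (_ | ⟨w, L₂⟩) - h₂ h
    · rfl
    · exact absurd h.symm (hne w (h₂ w List.mem_cons_self) _)
  | cons v L₁ ih =>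
    rintro (_ | ⟨w, L₂⟩) h₁ h₂ h
    · exact absurd h (hne v (h₁ v List.mem_cons_self) _)
    · have hv := h₁ v List.mem_cons_self
      have hw := h₂ w List.mem_cons_self
      rw [List.flatten_cons, List.flatten_cons] at h
      obtain rfl : v = w := by
        rcases List.prefix_or_prefix_of_prefix (List.prefix_append v L₁.flatten)
          (h ▸ List.prefix_append w L₂.flatten) with hvw | hwv
        · exact hS v hv w hw hvw
        · exact (hS w hw v hv hwv).symm
      rw [ih L₂ (fun u hu => h₁ u (List.mem_cons_of_mem _ hu))
        (fun u hu => h₂ u (List.mem_cons_of_mem _ hu)) (List.append_cancel_left h)]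

/-- The weight `2^{-|π|}` of a program `π`. -/
def programWeight (π : List Bool) : ℝ≥0∞ := 2⁻¹ ^ π.length

theorem programWeight_eq_ofReal (π : List Bool) :
    programWeight π = ENNReal.ofReal ((1 / 2) ^ π.length) := by
  rw [programWeight, ENNReal.ofReal_pow (by norm_num), one_div, ENNReal.ofReal_inv_of_pos two_pos,
    ENNReal.ofReal_ofNat]

theorem tsum_programWeight_le_one {S : Set (List Bool)}
    (hS : ∀ π ∈ S, ∀ ρ ∈ S, π <+: ρ → π = ρ) : ∑' π : S, programWeight π ≤ 1 := by
  by_cases hnil : [] ∈ S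
  · obtain rfl : S = {[]} := Set.eq_singleton_iff_unique_mem.2
      ⟨hnil, fun π hπ => (hS [] hnil π hπ List.nil_prefix).symm⟩
    simp [programWeight]
  rw [ENNReal.tsum_eq_iSup_sum]
  refine iSup_le fun T => ?_
  let T' : Finset (List Bool) := T.map (Function.Embedding.subtype _)
  have hT' : ∀ π ∈ (T' : Set (List Bool)), π ∈ S := fun π hπ => by
    obtain ⟨ρ, -, rfl⟩ := Finset.mem_map.1 hπ
    exact ρ.2
  have hdecodable : InformationTheory.UniquelyDecodable (T' : Set (List Bool)) :=
    uniquelyDecodable_of_prefixFree (fun h => hnil (hT' _ h))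
      fun π hπ ρ hρ => hS π (hT' π hπ) ρ (hT' ρ hρ)
  calc ∑ π ∈ T, programWeight π = ∑ π ∈ T', programWeight π := by simp [T']
    _ = ENNReal.ofReal (∑ π ∈ T', (1 / 2) ^ π.length) := by
        rw [ENNReal.ofReal_sum_of_nonneg fun π _ => by positivity]
        exact Finset.sum_congr rfl fun π _ => programWeight_eq_ofReal π
    _ ≤ 1 := by simpa using InformationTheory.kraft_mcmillan_inequality hdecodable

/-! ### Strongly finite outer measures -/

variable {n : ℕ}

theorem StronglyFinite.le_tsum {μ : OuterMeasure (EuclideanSpace ℝ (Fin n))}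
    (hμ : StronglyFinite μ) (E : Set (EuclideanSpace ℝ (Fin n))) :
    μ E ≤ ∑' q : ratPoint ⁻¹' E, μ {ratPoint q.1} := by
  have hE : E ⊆ (Set.range (ratPoint (n := n)))ᶜ ∪ ⋃ q : ratPoint ⁻¹' E, {ratPoint q.1} := by
    intro x hx
    by_cases hrange : x ∈ Set.range (ratPoint (n := n))
    · obtain ⟨q, rfl⟩ := hrange
      exact Or.inr (Set.mem_iUnion.2 ⟨⟨q, hx⟩, rfl⟩)
    · exact Or.inl hrange
  calc μ E ≤ μ (Set.range (ratPoint (n := n)))ᶜ + μ (⋃ q : ratPoint ⁻¹' E, {ratPoint q.1}) :=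
        (measure_mono hE).trans (measure_union_le _ _)
    _ ≤ 0 + ∑' q : ratPoint ⁻¹' E, μ {ratPoint q.1} :=
        add_le_add hμ.1.le (measure_iUnion_le _)
    _ = _ := zero_add _

theorem StronglyFinite.lt_top {μ : OuterMeasure (EuclideanSpace ℝ (Fin n))}
    (hμ : StronglyFinite μ) (E : Set (EuclideanSpace ℝ (Fin n))) : μ E < ∞ :=
  (hμ.le_tsum E).trans_lt <| (ENNReal.tsum_comp_le_tsum_of_injective
    Subtype.val_injective fun q : Fin n → ℚ => μ {ratPoint q}).trans_lt hμ.2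

theorem StronglyFinite.finitelySupported {μ : OuterMeasure (EuclideanSpace ℝ (Fin n))}
    (hμ : StronglyFinite μ) : FinitelySupported μ := by
  intro ε hε
  obtain ⟨A, hA⟩ :=
    ((tendsto_order.1 (ENNReal.tendsto_tsum_compl_atTop_zero hμ.2.ne)).2 ε hε).exists
  have hcompl : ratPoint ⁻¹' (ratPoint '' (A : Set (Fin n → ℚ)))ᶜ = {q | q ∉ A} := by
    ext q
    simp [ratPoint_injective.eq_iff]
  have h := hμ.le_tsum (ratPoint '' (A : Set (Fin n → ℚ)))ᶜ
  rw [hcompl] at h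
  exact ⟨A, h.trans_lt hA⟩

/-! ### The outer measure of the programs of a prefix machine -/

/-- The discrete outer measure that gives each rational point the total weight of its programs. It
plays the part of the universal discrete semimeasure. -/
def programMeasure (U : List Bool →. List Bool) (n : ℕ) :
    OuterMeasure (EuclideanSpace ℝ (Fin n)) :=
  OuterMeasure.sum fun π =>
    programWeight π •
      ⨆ q : {q : Fin n → ℚ // pointString q ∈ U π}, OuterMeasure.dirac (ratPoint q.1)

/-- The programs for the rational points of `E`. -/
def programsFor (U : List Bool →. List Bool) (E : Set (EuclideanSpace ℝ (Fin n))) :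
    Set (List Bool) :=
  {π | ∃ q : Fin n → ℚ, pointString q ∈ U π ∧ ratPoint q ∈ E}

theorem programMeasure_apply (U : List Bool →. List Bool) (E : Set (EuclideanSpace ℝ (Fin n))) :
    programMeasure U n E = ∑' π : programsFor U E, programWeight π := by
  rw [tsum_subtype (programsFor U E) programWeight]
  simp only [programMeasure, OuterMeasure.sum_apply, FunLike.coe_smul, Pi.smul_apply,
    OuterMeasure.iSup_apply, OuterMeasure.dirac_apply, smul_eq_mul]
  refine tsum_congr fun π => ?_
  by_cases hπ : π ∈ programsFor U E
  · obtain ⟨q, hq, hE⟩ := hπ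
    rw [Set.indicator_of_mem (show π ∈ programsFor U E from ⟨q, hq, hE⟩)]
    refine (congrArg _ (le_antisymm (iSup_le fun q => Set.indicator_le_self _ _ _) ?_)).trans
      (mul_one _)
    exact le_iSup_of_le ⟨q, hq⟩ (Set.indicator_of_mem (f := fun _ => 1) hE).ge
  · rw [Set.indicator_of_notMem hπ, mul_eq_zero]
    exact Or.inr (ENNReal.iSup_eq_zero.2 fun q =>
      Set.indicator_of_notMem (fun hE => hπ ⟨q, q.2, hE⟩) _)

theorem programWeight_le_programMeasure {U : List Bool →. List Bool} {π : List Bool}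
    {E : Set (EuclideanSpace ℝ (Fin n))} (hπ : π ∈ programsFor U E) :
    programWeight π ≤ programMeasure U n E := by
  rw [programMeasure_apply]
  exact ENNReal.le_tsum (f := fun π : programsFor U E => programWeight π) ⟨π, hπ⟩

theorem stronglyFinite_programMeasure {U : List Bool →. List Bool} (hU : IsPrefixMachine U) :
    StronglyFinite (programMeasure U n) := by
  constructor
  · have hempty : programsFor U (Set.range (ratPoint (n := n)))ᶜ = ∅ :=
      Set.eq_empty_of_forall_notMem fun π ⟨q, _, hq⟩ => hq ⟨q, rfl⟩
    rw [programMeasure_apply, hempty, tsum_empty]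
  · have hdom : ∀ p : Σ q : Fin n → ℚ, programsFor U {ratPoint q},
        pointString p.1 ∈ U p.2.1 := by
      rintro ⟨q, π, q', hq', heq⟩
      exact ratPoint_injective heq ▸ hq'
    have hinj : Function.Injective fun p : Σ q : Fin n → ℚ, programsFor U {ratPoint q} =>
        (⟨p.2.1, Part.dom_iff_mem.2 ⟨_, hdom p⟩⟩ : {π | (U π).Dom}) := by
      rintro ⟨q, π, hπ⟩ ⟨q', π', hπ'⟩ heq
      obtain rfl : π = π' := congrArg Subtype.val heq
      obtain rfl : q = q' := pointString_injective
        (Part.mem_unique (hdom ⟨q, π, hπ⟩) (hdom ⟨q', π, hπ'⟩))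
      rfl
    calc ∑' q : Fin n → ℚ, programMeasure U n {ratPoint q}
        = ∑' p : Σ q : Fin n → ℚ, programsFor U {ratPoint q}, programWeight p.2 := by
          simp only [programMeasure_apply, ENNReal.tsum_sigma']
      _ ≤ ∑' π : {π | (U π).Dom}, programWeight π := ENNReal.tsum_comp_le_tsum_of_injective hinj _
      _ ≤ 1 := tsum_programWeight_le_one fun π hπ ρ hρ => hU.prefixFree π ρ hπ hρ
      _ < ∞ := ENNReal.one_lt_top

theorem rePred_mem_of_partrec {α σ : Type*} [Primcodable α] [Primcodable σ] {f : α →. σ}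
    (hf : Partrec f) : REPred fun p : α × σ => p.2 ∈ f p.1 := by
  classical
  have hsearch : Partrec fun p : α × σ =>
      (f p.1).bind fun y => bif decide (y = p.2) then Part.some () else Part.none :=
    Partrec.bind (hf.comp Computable.fst) <| Partrec.cond
      (Primrec.eq.decide.comp Primrec.snd (Primrec.snd.comp Primrec.fst)).to_comp
      (Computable.const ()).partrec Partrec.none
  refine hsearch.dom_re.of_eq fun p => ?_
  constructor
  · rintro ⟨hdom, heq⟩
    by_cases h : (f p.1).get hdom = p.2
    · exact h ▸ Part.get_mem hdom
    · simp [h] at heq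
  · intro hp
    rw [Part.dom_iff_mem]
    exact ⟨(), Part.mem_bind hp (by simp)⟩

/-- The programs with number below `t` for which `R`, the graph of a machine enumerated in stages,
confirms at stage `t` that they compute an element of `L`. -/
def stagePrograms {α : Type*} (R : List Bool × α → ℕ → Prop) (L : List α) (t : ℕ) :
    List (List Bool) :=
  open Classical in (List.range t).filterMap fun k => (Encodable.decode₂ (List Bool) k).bind
    fun π => if ∃ a ∈ L, R (π, a) t then some π else none

section StagePrograms

variable {α : Type*} {R : List Bool × α → ℕ → Prop}

theorem mem_stagePrograms {L : List α} {t : ℕ} {π : List Bool} :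
    π ∈ stagePrograms R L t ↔ Encodable.encode π < t ∧ ∃ a ∈ L, R (π, a) t := by
  simp only [stagePrograms, List.mem_filterMap, List.mem_range, Option.bind_eq_some_iff,
    Encodable.decode₂_eq_some, Option.ite_none_right_eq_some, Option.some.injEq]
  constructor
  · rintro ⟨_, hlt, π, rfl, hR, rfl⟩
    exact ⟨hlt, hR⟩
  · rintro ⟨hlt, hR⟩
    exact ⟨_, hlt, π, rfl, hR, rfl⟩

theorem nodup_stagePrograms (L : List α) (t : ℕ) : (stagePrograms R L t).Nodup := by
  refine List.nodup_range.filterMap fun i j π hi hj => ?_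
  simp only [Option.mem_def, Option.bind_eq_some_iff, Encodable.decode₂_eq_some,
    Option.ite_none_right_eq_some, Option.some.injEq] at hi hj
  obtain ⟨_, rfl, -, rfl⟩ := hi
  obtain ⟨_, rfl, -, rfl⟩ := hj
  rfl

theorem primrec_stagePrograms [Primcodable α] (hR : PrimrecRel R) :
    Primrec₂ (stagePrograms R) := by
  classical
  have hcomputes : PrimrecRel fun (a : α) (z : List Bool × ℕ) => R (z.1, a) z.2 :=
    hR.comp (Primrec.pair (Primrec.fst.comp Primrec.snd) Primrec.fst)
      (Primrec.snd.comp Primrec.snd)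
  refine Primrec.listFilterMap (Primrec.list_range.comp Primrec.snd) <|
    Primrec.option_bind (Primrec.decode₂.comp Primrec.snd) <|
      Primrec.ite ?_ (Primrec.option_some.comp Primrec.snd) (Primrec.const none)
  exact hcomputes.exists_mem_list.comp (Primrec.fst.comp (Primrec.fst.comp Primrec.fst))
    (Primrec.pair Primrec.snd (Primrec.snd.comp (Primrec.fst.comp Primrec.fst)))

theorem monotone_stagePrograms (hmono : ∀ p s t, s ≤ t → R p s → R p t) (L : List α) :
    Monotone fun t => {π | π ∈ stagePrograms R L t} := by
  intro s t hst π hπ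
  obtain ⟨hlt, a, ha, hRa⟩ := mem_stagePrograms.1 hπ
  exact mem_stagePrograms.2 ⟨hlt.trans_le hst, a, ha, hmono _ _ _ hst hRa⟩

theorem iUnion_stagePrograms (hmono : ∀ p s t, s ≤ t → R p s → R p t) (L : List α) :
    ⋃ t, {π | π ∈ stagePrograms R L t} = {π | ∃ a ∈ L, ∃ t, R (π, a) t} := by
  ext π
  simp only [Set.mem_iUnion, Set.mem_ofPred_eq, mem_stagePrograms]
  constructor
  · rintro ⟨t, -, a, ha, hRa⟩
    exact ⟨a, ha, t, hRa⟩
  · rintro ⟨a, ha, t, hRa⟩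
    exact ⟨max t (Encodable.encode π + 1), by omega, a, ha, hmono _ _ _ (le_max_left _ _) hRa⟩

/-- The total weight of the stage `t` programs, as a multiple of `2^{-t}`. -/
def stageNumerator (R : List Bool × α → ℕ → Prop) (L : List α) (t : ℕ) : ℕ :=
  ((stagePrograms R L t).map fun π => 2 ^ (t - π.length)).sum

theorem primrec_list_sum : Primrec (List.sum : List ℕ → ℕ) :=
  Primrec.list_foldr Primrec.id (Primrec.const 0)
    (h := fun _ p => p.1 + p.2)
    (Primrec.nat_add.comp (Primrec.fst.comp Primrec.snd) (Primrec.snd.comp Primrec.snd))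

theorem primrec_stageNumerator [Primcodable α] (hR : PrimrecRel R) :
    Primrec₂ (stageNumerator R) :=
  primrec_list_sum.comp <| Primrec.list_map (primrec_stagePrograms hR) <|
    primrec_nat_pow.comp (Primrec.const 2) (Primrec.nat_sub.comp
      (Primrec.snd.comp Primrec.fst) (Primrec.list_length.comp Primrec.snd))

theorem stageNumerator_congr {L L' : List α} (h : ∀ a, a ∈ L ↔ a ∈ L') (t : ℕ) :
    stageNumerator R L t = stageNumerator R L' t := by
  unfold stageNumerator stagePrograms
  congr! 7
  rw [h]

theorem pow_sub_length_div {π : List Bool} {t : ℕ} (h : π.length ≤ t) :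
    ((2 ^ (t - π.length) : ℕ) : ℝ≥0∞) / 2 ^ t = programWeight π := by
  obtain ⟨k, rfl⟩ := Nat.exists_eq_add_of_le h
  rw [Nat.add_sub_cancel_left, programWeight, ← ENNReal.inv_pow, pow_add]
  simpa using ENNReal.mul_div_mul_right 1 (2 ^ π.length) (c := 2 ^ k) (by simp) (by simp)

theorem stageNumerator_div (L : List α) (t : ℕ) :
    (stageNumerator R L t : ℝ≥0∞) / 2 ^ t =
      ∑' π : {π | π ∈ stagePrograms R L t}, programWeight π := by
  classical
  have hcoe : {π | π ∈ stagePrograms R L t} = ↑(stagePrograms R L t).toFinset := by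
    ext π
    simp
  rw [hcoe, Finset.tsum_subtype', List.sum_toFinset _ (nodup_stagePrograms L t), stageNumerator,
    Nat.cast_list_sum, List.map_map, div_eq_mul_inv, ← List.sum_map_mul_right]
  refine congrArg List.sum (List.map_congr_left fun π hπ => ?_)
  exact pow_sub_length_div
    ((Encodable.length_le_encode π).trans (mem_stagePrograms.1 hπ).1.le)

end StagePrograms

theorem tsum_iSup_eq_of_monotone {α : Type*} (a : ℕ → α → ℝ≥0∞) (ha : Monotone a) :
    ∑' x, ⨆ t, a t x = ⨆ t, ∑' x, a t x := by
  simp only [ENNReal.tsum_eq_iSup_sum]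
  rw [iSup_comm]
  exact iSup_congr fun T => ENNReal.finsetSum_iSup_of_monotone fun x s t hst => ha hst x

theorem tendsto_tsum_iUnion {α : Type*} (w : α → ℝ≥0∞) {S : ℕ → Set α} (hS : Monotone S) :
    Tendsto (fun t => ∑' x : S t, w x) atTop (𝓝 (∑' x : ↥(⋃ t, S t), w x)) := by
  have hmono : Monotone fun t => (S t).indicator w := fun s t hst =>
    Set.indicator_le_indicator_of_subset (hS hst) fun _ => zero_le
  simp only [tsum_subtype, Set.indicator_iUnion_apply (bot_eq_zero (α := ℝ≥0∞)),
    tsum_iSup_eq_of_monotone _ hmono]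
  exact tendsto_atTop_iSup fun s t hst => ENNReal.tsum_le_tsum (hmono hst)

theorem lowerSemicomputable_programMeasure {U : List Bool →. List Bool} (hU : IsPrefixMachine U) :
    LowerSemicomputable (programMeasure U n) := by
  have hgraph : REPred fun p : List Bool × (Fin n → ℤ × ℕ) => binaryString p.2 ∈ U p.1 :=
    (rePred_mem_of_partrec hU.partrec).comp
      (Primrec.pair Primrec.fst (primrec_binaryString.comp Primrec.snd)).to_comp
  obtain ⟨R, hR, hmono, hR_iff⟩ := exists_primrecRel_of_rePred hgraph
  let S : Finset (Fin n → ℚ) → ℕ → Set (List Bool) := fun A t =>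
    {π | π ∈ stagePrograms R (A.toList.map pointCode) t}
  let f : Finset (Fin n → ℚ) → ℕ → ℚ≥0 := fun A t =>
    (stageNumerator R (A.toList.map pointCode) t : ℚ≥0) / 2 ^ t
  have hf : ∀ A t, ((f A t : ℝ≥0) : ℝ≥0∞) = ∑' π : S A t, programWeight π := fun A t => by
    rw [← stageNumerator_div, NNRat.cast_div, ENNReal.coe_div (by simp)]
    simp
  have hS_mono : ∀ A, Monotone (S A) := fun A => monotone_stagePrograms hmono _
  have hS_iUnion : ∀ A : Finset (Fin n → ℚ),
      ⋃ t, S A t = programsFor U (ratPoint '' (A : Set (Fin n → ℚ))) := fun A => by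
    refine (iUnion_stagePrograms hmono _).trans (Set.ext fun π => ?_)
    simp [← hR_iff, programsFor, pointString, ratPoint_injective.eq_iff, and_comm]
  refine ⟨(stronglyFinite_programMeasure hU).finitelySupported, f,
    ⟨fun L t => ratCode (mkRat (stageNumerator R L t) (2 ^ t)), ?_, fun l t => ?_⟩,
    fun A s t hst => ⟨?_, ?_⟩, fun A => ?_⟩
  · exact (primrec_ratCode_mkRat.comp
      (primrec_int_natCast.comp (primrec_stageNumerator hR))
      (primrec_nat_pow.comp (Primrec.const 2) Primrec.snd)).to_comp
  · beta_reduce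
    rw [Rat.mkRat_eq_div, stageNumerator_congr (L' := l.toFinset.toList.map pointCode) (by simp)]
    simp [f]
  · have hle : ((f A s : ℝ≥0) : ℝ≥0∞) ≤ ((f A t : ℝ≥0) : ℝ≥0∞) := by
      rw [hf, hf]
      exact ENNReal.tsum_mono_subtype _ (hS_mono A hst)
    exact_mod_cast hle
  · rw [hf, programMeasure_apply, ← hS_iUnion]
    exact ENNReal.tsum_mono_subtype _ (Set.subset_iUnion _ t)
  · simp only [hf]
    rw [programMeasure_apply, ← hS_iUnion]
    exact tendsto_tsum_iUnion _ (hS_mono A)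

/-! ### Enumeration without repetitions -/

section Enumeration

variable {α β : Type*} [Primcodable α] [Primcodable β] {P : β → α → Prop}

theorem exists_primrec_injective_listing (hP : REPred fun p : β × α => P p.1 p.2) :
    ∃ g : β → ℕ → Option α, Primrec₂ g ∧ (∀ b a, P b a ↔ ∃ k, g b k = some a) ∧
      ∀ b k l a, g b k = some a → g b l = some a → k = l := by
  classical
  obtain ⟨R, hR, -, hPR⟩ := exists_primrecRel_of_rePred hP
  have hfirst : PrimrecRel fun (y : β × α) (t : ℕ) => R y t ∧ ∀ s < t, ¬ R y s :=
    PrimrecPred.and hR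
      (hR.not.swap.forall_mem_list.comp (Primrec.list_range.comp Primrec.snd) Primrec.fst |>.of_eq
        fun p => by simp only [Function.swap, List.mem_range])
  let g : β → ℕ → Option α := fun b k => (Encodable.decode₂ (α × ℕ) k).bind fun p =>
    if R (b, p.1) p.2 ∧ ∀ s < p.2, ¬ R (b, p.1) s then some p.1 else none
  have hg : ∀ b k a, g b k = some a ↔ ∃ t, Encodable.encode (a, t) = k ∧
      R (b, a) t ∧ ∀ s < t, ¬ R (b, a) s := by
    intro b k a
    simp only [g, Option.bind_eq_some_iff, Encodable.decode₂_eq_some,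
      Option.ite_none_right_eq_some, Option.some.injEq]
    constructor
    · rintro ⟨⟨_, t⟩, hk, ht, rfl⟩
      exact ⟨t, hk, ht⟩
    · rintro ⟨t, hk, ht⟩
      exact ⟨(a, t), hk, ht, rfl⟩
  refine ⟨g, ?_, fun b a => ?_, fun b k l a hk hl => ?_⟩
  · exact Primrec.option_bind (Primrec.decode₂.comp Primrec.snd) <|
      Primrec.ite (hfirst.comp
        (Primrec.pair (Primrec.fst.comp Primrec.fst) (Primrec.fst.comp Primrec.snd))
        (Primrec.snd.comp Primrec.snd))
        (Primrec.option_some.comp (Primrec.fst.comp Primrec.snd)) (Primrec.const none)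
  · rw [hPR (b, a)]
    constructor
    · exact fun h => ⟨_, (hg _ _ _).2 ⟨Nat.find h, rfl, Nat.find_spec h, fun s => Nat.find_min h⟩⟩
    · rintro ⟨k, hk⟩
      obtain ⟨t, -, ht, -⟩ := (hg _ _ _).1 hk
      exact ⟨t, ht⟩
  · obtain ⟨s, rfl, hs, hs_min⟩ := (hg _ _ _).1 hk
    obtain ⟨t, rfl, ht, ht_min⟩ := (hg _ _ _).1 hl
    obtain rfl : s = t :=
      le_antisymm (not_lt.1 fun h => hs_min t h ht) (not_lt.1 fun h => ht_min s h hs)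
    rfl

theorem primrec_nat_count {p : β → ℕ → Prop} [∀ b, DecidablePred (p b)] (hp : PrimrecRel p) :
    Primrec₂ fun b => Nat.count (p b) := by
  classical
  refine (Primrec.list_length.comp (hp.swap.listFilter.comp
    (Primrec.list_range.comp Primrec.snd) Primrec.fst)).of_eq fun y => ?_
  simp only [Nat.count, List.countP_eq_length_filter, Function.swap]

theorem exists_partrec_enumeration (hP : REPred fun p : β × α => P p.1 p.2) :
    ∃ e : β × ℕ →. α, Partrec e ∧
      (∀ b i, (e (b, i)).Dom → ((i + 1 : ℕ) : ℕ∞) ≤ {a | P b a}.encard) ∧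
      ∀ b a, P b a → ∃ i, a ∈ e (b, i) := by
  classical
  obtain ⟨g, hg, hPg, hg_inj⟩ := exists_primrec_injective_listing hP
  let rank : β → ℕ → ℕ := fun b => Nat.count fun k => (g b k).isSome
  have hrank : Primrec₂ rank :=
    primrec_nat_count (p := fun b k => (g b k).isSome = true)
      (Primrec.eq.comp (Primrec.option_isSome.comp hg) (Primrec.const true))
  have hrank_inj : ∀ b k l, (g b k).isSome → (g b l).isSome → rank b k = rank b l → k = l :=
    fun b k l => Nat.count_injective (p := fun k => (g b k).isSome = true)
  let search : β × ℕ → ℕ → Option α := fun p k => if rank p.1 k = p.2 then g p.1 k else none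
  have hsearch : ∀ b i k a, search (b, i) k = some a ↔ rank b k = i ∧ g b k = some a :=
    fun b i k a => Option.ite_none_right_eq_some
  refine ⟨fun p => Nat.rfindOpt (search p), Partrec.rfindOpt (Primrec.to_comp ?_),
    fun b i hi => ?_, fun b a ha => ?_⟩
  · exact Primrec.ite (Primrec.eq.comp
      (hrank.comp (Primrec.fst.comp Primrec.fst) Primrec.snd) (Primrec.snd.comp Primrec.fst))
      (hg.comp (Primrec.fst.comp Primrec.fst) Primrec.snd) (Primrec.const none)
  · obtain ⟨k, a, hk⟩ := Nat.rfindOpt_dom.1 hi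
    obtain ⟨rfl, hka⟩ := (hsearch b i k a).1 hk
    have hcount : rank b k + 1 = ((Finset.range (k + 1)).filter fun l => (g b l).isSome).card := by
      rw [← Nat.count_eq_card_filter_range, Nat.count_succ, if_pos (by simp [hka])]
    rw [hcount, ← Set.encard_coe_eq_coe_finsetCard,
      ← (Option.some_injective α).encard_image {a | P b a}]
    refine Set.encard_le_encard_of_injOn (f := g b) (fun l hl => ?_) fun l hl l' _ heq => ?_
    · obtain ⟨a', ha'⟩ := Option.isSome_iff_exists.1 (Finset.mem_filter.1 hl).2
      exact ⟨a', (hPg b a').2 ⟨l, ha'⟩, ha'.symm⟩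
    · obtain ⟨a', ha'⟩ := Option.isSome_iff_exists.1 (Finset.mem_filter.1 hl).2
      exact hg_inj b l l' a' ha' (heq ▸ ha')
  · obtain ⟨k, hk⟩ := (hPg b a).1 ha
    have hdom : (Nat.rfindOpt (search (b, rank b k))).Dom :=
      Nat.rfindOpt_dom.2 ⟨k, a, (hsearch ..).2 ⟨rfl, hk⟩⟩
    obtain ⟨l, hl⟩ := Nat.rfindOpt_spec (Part.get_mem hdom)
    obtain ⟨hrank_eq, hl⟩ := (hsearch ..).1 hl
    obtain rfl : l = k := hrank_inj b l k (by simp [hl]) (by simp [hk]) hrank_eq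
    exact ⟨_, Option.some.inj (hl.symm.trans hk) ▸ Part.get_mem hdom⟩

end Enumeration

/-! ### Prefix codes -/

/-- A self-delimiting form of `u`: its length in unary, a separator, and `u` itself. -/
def selfDelimit (u : List Bool) : List Bool := List.replicate u.length true ++ false :: u

theorem length_selfDelimit (u : List Bool) : (selfDelimit u).length = 2 * u.length + 1 := by
  simp only [selfDelimit, List.length_append, List.length_replicate, List.length_cons]
  omega

theorem replicate_true_append_false_isPrefix {a b : ℕ} {X Y : List Bool}
    (h : List.replicate a true ++ false :: X <+: List.replicate b true ++ false :: Y) :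
    a = b ∧ X <+: Y := by
  induction a generalizing b with
  | zero =>
    cases b with
    | zero => simpa using h
    | succ b => simp [List.replicate_succ] at h
  | succ a ih =>
    cases b with
    | zero => simp [List.replicate_succ] at h
    | succ b =>
      simp only [List.replicate_succ, List.cons_append, List.cons_prefix_cons, true_and] at h
      exact ⟨by rw [(ih h).1], (ih h).2⟩

theorem selfDelimit_append_isPrefix {u v X Y : List Bool}
    (h : selfDelimit u ++ X <+: selfDelimit v ++ Y) : u = v ∧ X <+: Y := by
  simp only [selfDelimit, List.append_assoc, List.cons_append] at h
  obtain ⟨hlength, hpre⟩ := replicate_true_append_false_isPrefix h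
  obtain rfl : u = v :=
    (List.prefix_of_prefix_length_le ((List.prefix_append u X).trans hpre)
      (List.prefix_append v Y) hlength.le).eq_of_length hlength
  exact ⟨rfl, (List.prefix_append_right_inj u).1 hpre⟩

/-- The `k` lowest binary digits of `i`. For `i < 2 ^ k` this is a code of `i` of fixed length. -/
def lowBits (k i : ℕ) : List Bool := (List.range k).map i.testBit

theorem length_lowBits (k i : ℕ) : (lowBits k i).length = k := by
  rw [lowBits, List.length_map, List.length_range]

theorem lowBits_inj {k i j : ℕ} (hi : i < 2 ^ k) (hj : j < 2 ^ k) :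
    lowBits k i = lowBits k j ↔ i = j := by
  refine ⟨fun h => Nat.eq_of_testBit_eq fun l => ?_, fun h => h ▸ rfl⟩
  rcases lt_or_ge l k with hl | hl
  · exact List.map_inj_left.1 h l (List.mem_range.2 hl)
  · have hpow : 2 ^ k ≤ 2 ^ l := Nat.pow_le_pow_right two_pos hl
    rw [Nat.testBit_lt_two_pow (hi.trans_le hpow), Nat.testBit_lt_two_pow (hj.trans_le hpow)]

theorem primrec_selfDelimit : Primrec selfDelimit :=
  Primrec.list_append.comp ((primrec_list_replicate true).comp Primrec.list_length)
    (Primrec.list_cons.comp (Primrec.const false) Primrec.id)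

theorem primrec_lowBits : Primrec₂ lowBits :=
  Primrec.list_map (Primrec.list_range.comp Primrec.fst)
    (primrec_nat_testBit.comp (Primrec.snd.comp Primrec.fst) Primrec.snd)

/-! ### Prefix machines from codes -/

theorem exists_prefixMachine_of_prefixCode {γ : Type*} [Primcodable γ] {code : γ → List Bool}
    {f : γ →. List Bool} (hcode : Primrec code) (hf : Partrec f)
    (hprefixFree : ∀ a b, (f a).Dom → (f b).Dom → code a <+: code b → a = b) :
    ∃ M : List Bool →. List Bool, IsPrefixMachine M ∧ ∀ a, ∀ w ∈ f a, w ∈ M (code a) := by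
  classical
  obtain ⟨R, hR, -, hfR⟩ := exists_primrecRel_of_rePred (rePred_mem_of_partrec hf)
  let search : List Bool → ℕ → Option (List Bool) := fun π k =>
    (Encodable.decode (α := (γ × List Bool) × ℕ) k).bind fun y =>
      if π = code y.1.1 ∧ R y.1 y.2 then some y.1.2 else none
  have hsearch : Primrec₂ search := by
    refine Primrec.option_bind (Primrec.decode.comp Primrec.snd) <|
      Primrec.ite (PrimrecPred.and (Primrec.eq.comp (Primrec.fst.comp Primrec.fst)
        (hcode.comp (Primrec.fst.comp (Primrec.fst.comp Primrec.snd))))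
        (hR.comp (Primrec.fst.comp Primrec.snd) (Primrec.snd.comp Primrec.snd)))
        (Primrec.option_some.comp (Primrec.snd.comp (Primrec.fst.comp Primrec.snd)))
        (Primrec.const none)
  have hsound : ∀ π k w, search π k = some w → ∃ a, π = code a ∧ w ∈ f a := by
    intro π k w hk
    simp only [search, Option.bind_eq_some_iff, Option.ite_none_right_eq_some,
      Option.some.injEq] at hk
    obtain ⟨y, -, ⟨hπ, hy⟩, rfl⟩ := hk
    exact ⟨y.1.1, hπ, (hfR y.1).2 ⟨y.2, hy⟩⟩
  refine ⟨fun π => Nat.rfindOpt (search π), ⟨Partrec.rfindOpt hsearch.to_comp, ?_⟩, ?_⟩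
  · intro π ρ hπ hρ hpre
    obtain ⟨k, v, hk⟩ := Nat.rfindOpt_dom.1 hπ
    obtain ⟨l, w, hl⟩ := Nat.rfindOpt_dom.1 hρ
    obtain ⟨a, rfl, ha⟩ := hsound _ _ _ hk
    obtain ⟨b, rfl, hb⟩ := hsound _ _ _ hl
    rw [hprefixFree a b (Part.dom_iff_mem.2 ⟨v, ha⟩) (Part.dom_iff_mem.2 ⟨w, hb⟩) hpre]
  · intro a w hw
    obtain ⟨t, ht⟩ := (hfR (a, w)).1 hw
    have hdom : (Nat.rfindOpt (search (code a))).Dom :=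
      Nat.rfindOpt_dom.2 ⟨Encodable.encode ((a, w), t), w, by simp [search, ht]⟩
    obtain ⟨k, hk⟩ := Nat.rfindOpt_spec (Part.get_mem hdom)
    obtain ⟨b, hab, hb⟩ := hsound _ _ _ hk
    obtain rfl : a = b :=
      hprefixFree a b (Part.dom_iff_mem.2 ⟨w, hw⟩) (Part.dom_iff_mem.2 ⟨_, hb⟩)
        (hab ▸ List.prefix_rfl)
    exact Part.mem_unique hb hw ▸ Part.get_mem hdom

section Universal

variable {U : List Bool →. List Bool}

theorem complexity_le_length {π w : List Bool} (h : w ∈ U π) : complexity U w ≤ π.length :=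
  Nat.sInf_le ⟨π, h, rfl⟩

theorem exists_program_of_prefixCode (hU : IsUniversalPrefixMachine U) {γ : Type*}
    [Primcodable γ] {code : γ → List Bool} {f : γ →. List Bool} (hcode : Primrec code)
    (hf : Partrec f)
    (hprefixFree : ∀ a b, (f a).Dom → (f b).Dom → code a <+: code b → a = b) :
    ∃ C : ℕ, ∀ a, ∀ w ∈ f a, ∃ π, w ∈ U π ∧ π.length ≤ (code a).length + C := by
  obtain ⟨M, hM, hfM⟩ := exists_prefixMachine_of_prefixCode hcode hf hprefixFree
  obtain ⟨C, hC⟩ := hU.universal M hM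
  refine ⟨C, fun a w hw => ?_⟩
  obtain ⟨π, hπ, hw⟩ := hC _ _ (hfM a w hw)
  exact ⟨π, hw, hπ⟩

theorem exists_program (hU : IsUniversalPrefixMachine U) (w : List Bool) :
    ∃ π, w ∈ U π ∧ π.length = complexity U w := by
  obtain ⟨_, hC⟩ := exists_program_of_prefixCode hU (f := fun _ : Unit => Part.some w)
    (Primrec.const []) (Computable.const w).partrec fun _ _ _ _ _ => rfl
  obtain ⟨π, hπ, -⟩ := hC () w (Part.mem_some w)
  obtain ⟨ρ, hρ, h⟩ := Nat.sInf_mem (s := {k | ∃ π, w ∈ U π ∧ k = π.length}) ⟨_, π, hπ, rfl⟩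
  exact ⟨ρ, hρ, h.symm⟩

/-- The program describes the parameter `b` in self-delimiting form, followed by the position of `a`
in an enumeration of the fibre over `b`, written with `ℓ b` digits. -/
theorem exists_complexity_le_of_rePred (hU : IsUniversalPrefixMachine U) {α β : Type*}
    [Primcodable α] [Primcodable β] {P : β → α → Prop} (hP : REPred fun p : β × α => P p.1 p.2)
    {ℓ : β → ℕ} (hℓ : Primrec ℓ) (hcard : ∀ b, {a | P b a}.encard ≤ (2 ^ ℓ b : ℕ))
    {out : β × α → List Bool} (hout : Computable out) :
    ∃ C : ℕ, ∀ b a, P b a →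
      complexity U (out (b, a)) ≤ ℓ b + 2 * (binaryString b).length + C := by
  obtain ⟨e, he, he_card, he_surj⟩ := exists_partrec_enumeration hP
  let code : β × ℕ → List Bool := fun p => selfDelimit (binaryString p.1) ++ lowBits (ℓ p.1) p.2
  let f : β × ℕ →. List Bool := fun p => (e p).map fun a => out (p.1, a)
  have hcode : Primrec code :=
    Primrec.list_append.comp (primrec_selfDelimit.comp (primrec_binaryString.comp Primrec.fst))
      (primrec_lowBits.comp (hℓ.comp Primrec.fst) Primrec.snd)
  have hf : Partrec f :=
    he.map (hout.comp (Computable.pair (Computable.fst.comp Computable.fst) Computable.snd))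
  have hlt : ∀ b i, (f (b, i)).Dom → i < 2 ^ ℓ b := fun b i hi => by
    exact_mod_cast (he_card b i hi).trans (hcard b)
  obtain ⟨C, hC⟩ := exists_program_of_prefixCode hU hcode hf (by
    rintro ⟨b, i⟩ ⟨b', j⟩ hi hj hpre
    obtain ⟨hbb', hbits⟩ := selfDelimit_append_isPrefix hpre
    obtain rfl : b = b' := binaryString_injective hbb'
    rw [(lowBits_inj (hlt b i hi) (hlt b j hj)).1
      (hbits.eq_of_length (by rw [length_lowBits, length_lowBits]))])
  refine ⟨C + 1, fun b a ha => ?_⟩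
  obtain ⟨i, hi⟩ := he_surj b a ha
  obtain ⟨π, hπ, hlength⟩ := hC (b, i) _ (Part.mem_map _ hi)
  simp only [code, List.length_append, length_selfDelimit, length_lowBits] at hlength
  refine (complexity_le_length hπ).trans (hlength.trans_eq ?_)
  ring

end Universal

/-! ### Dyadic cubes -/

/-- The address of the `r`-dyadic cube that contains `x`. -/
def dyadicAddress (r : ℕ) (x : EuclideanSpace ℝ (Fin n)) : Fin n → ℤ := fun i => ⌊x i * 2 ^ r⌋

theorem mem_dyadicCube_iff {r : ℕ} {m : Fin n → ℤ} {x : EuclideanSpace ℝ (Fin n)} :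
    x ∈ dyadicCube r m ↔ dyadicAddress r x = m := by
  rw [funext_iff]
  refine forall_congr' fun i => ?_
  rw [dyadicAddress, Int.floor_eq_iff, div_le_iff₀ (by positivity), lt_div_iff₀ (by positivity)]

theorem dist_le_sum_abs_sub (x y : EuclideanSpace ℝ (Fin n)) : dist x y ≤ ∑ i, |x i - y i| := by
  rw [EuclideanSpace.dist_eq]
  refine Real.sqrt_le_iff.2 ⟨Finset.sum_nonneg fun i _ => abs_nonneg _, ?_⟩
  exact Finset.sum_sq_le_sq_sum_of_nonneg fun i _ => dist_nonneg

theorem abs_sub_le_dist (x y : EuclideanSpace ℝ (Fin n)) (i : Fin n) : |x i - y i| ≤ dist x y := by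
  rw [dist_eq_norm]
  exact PiLp.norm_apply_le (x - y) i

theorem dist_lt_of_dyadicAddress_eq {r : ℕ} {x y : EuclideanSpace ℝ (Fin n)}
    (h : dyadicAddress (r + n) x = dyadicAddress (r + n) y) : dist x y < ((2 : ℝ) ^ r)⁻¹ := by
  have hcoord : ∀ i, |x i - y i| ≤ ((2 : ℝ) ^ (r + n))⁻¹ := fun i => by
    have hfloor := Int.abs_sub_lt_one_of_floor_eq_floor (congrFun h i)
    rw [← sub_mul, abs_mul, abs_of_pos (show (0 : ℝ) < 2 ^ (r + n) by positivity)] at hfloor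
    rw [← one_div, le_div_iff₀ (by positivity)]
    exact hfloor.le
  calc dist x y ≤ ∑ i, |x i - y i| := dist_le_sum_abs_sub x y
    _ ≤ ∑ _i : Fin n, ((2 : ℝ) ^ (r + n))⁻¹ := Finset.sum_le_sum fun i _ => hcoord i
    _ = n / 2 ^ n * ((2 : ℝ) ^ r)⁻¹ := by
        rw [Finset.sum_const, Finset.card_univ, Fintype.card_fin, nsmul_eq_mul, pow_add]
        field_simp
    _ < ((2 : ℝ) ^ r)⁻¹ := by
        refine mul_lt_of_lt_one_left (by positivity) ((div_lt_one (by positivity)).2 ?_)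
        exact_mod_cast Nat.lt_two_pow_self

theorem dyadicAddress_mem_Icc {r : ℕ} {x y : EuclideanSpace ℝ (Fin n)}
    (h : y ∈ Metric.ball x ((2 : ℝ) ^ r)⁻¹) (i : Fin n) :
    dyadicAddress r y i ∈ Finset.Icc (dyadicAddress r x i - 1) (dyadicAddress r x i + 1) := by
  have hclose : |y i * 2 ^ r - x i * 2 ^ r| < 1 := by
    rw [← sub_mul, abs_mul, abs_of_pos (show (0 : ℝ) < 2 ^ r by positivity),
      ← lt_div_iff₀ (by positivity), one_div]
    exact (abs_sub_le_dist y x i).trans_lt h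
  obtain ⟨hlower, hupper⟩ := abs_lt.1 hclose
  have hy := Int.floor_le (y i * 2 ^ r)
  have hx := Int.lt_floor_add_one (x i * 2 ^ r)
  rw [Finset.mem_Icc, dyadicAddress, dyadicAddress, Int.le_floor, ← Int.lt_add_one_iff]
  constructor
  · push_cast
    linarith [Int.floor_le (x i * 2 ^ r)]
  · rw [← Int.cast_lt (R := ℝ)]
    push_cast
    linarith

theorem exists_lt_measure_dyadicCube_inter_ball {μ : OuterMeasure (EuclideanSpace ℝ (Fin n))}
    {x : EuclideanSpace ℝ (Fin n)} {r : ℕ} {c : ℝ≥0∞}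
    (h : 3 ^ n * c < μ (Metric.ball x ((2 : ℝ) ^ r)⁻¹)) :
    ∃ m, c < μ (dyadicCube r m ∩ Metric.ball x ((2 : ℝ) ^ r)⁻¹) := by
  let T : Finset (Fin n → ℤ) := Fintype.piFinset fun i =>
    Finset.Icc (dyadicAddress r x i - 1) (dyadicAddress r x i + 1)
  have hcard : T.card = 3 ^ n := by
    have hthree : ∀ a : ℤ, (Finset.Icc (a - 1) (a + 1)).card = 3 := fun a => by
      rw [Int.card_Icc]
      omega
    simp only [T, Fintype.card_piFinset, hthree, Finset.prod_const, Finset.card_univ,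
      Fintype.card_fin]
  have hcover : Metric.ball x ((2 : ℝ) ^ r)⁻¹ ⊆
      ⋃ m ∈ T, dyadicCube r m ∩ Metric.ball x ((2 : ℝ) ^ r)⁻¹ := fun y hy =>
    Set.mem_iUnion₂.2 ⟨dyadicAddress r y, Fintype.mem_piFinset.2 (dyadicAddress_mem_Icc hy),
      mem_dyadicCube_iff.2 rfl, hy⟩
  have hsum : ∑ _m ∈ T, c < ∑ m ∈ T, μ (dyadicCube r m ∩ Metric.ball x ((2 : ℝ) ^ r)⁻¹) := by
    rw [Finset.sum_const, hcard, nsmul_eq_mul, Nat.cast_pow, Nat.cast_ofNat]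
    exact h.trans_le ((measure_mono hcover).trans (measure_biUnion_finset_le _ _))
  obtain ⟨m, -, hm⟩ := Finset.exists_lt_of_sum_lt hsum
  exact ⟨m, hm⟩

theorem StronglyFinite.encard_heavyCubes_mul_le {μ : OuterMeasure (EuclideanSpace ℝ (Fin n))}
    (hμ : StronglyFinite μ) (r : ℕ) (c : ℝ≥0∞) :
    {m | c < μ (dyadicCube r m)}.encard * c ≤ ∑' q : Fin n → ℚ, μ {ratPoint q} := by
  have hpreimage : ∀ m, ratPoint ⁻¹' dyadicCube r m =
      (fun q : Fin n → ℚ => dyadicAddress r (ratPoint q)) ⁻¹' {m} := fun m =>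
    Set.ext fun q => mem_dyadicCube_iff
  calc {m | c < μ (dyadicCube r m)}.encard * c
      = ∑' _m : {m | c < μ (dyadicCube r m)}, c := (ENNReal.tsum_set_const _ c).symm
    _ ≤ ∑' m : {m | c < μ (dyadicCube r m)}, μ (dyadicCube r m) :=
        ENNReal.tsum_le_tsum fun m => m.2.le
    _ ≤ ∑' m, μ (dyadicCube r m) :=
        ENNReal.tsum_comp_le_tsum_of_injective Subtype.val_injective _
    _ ≤ ∑' m, ∑' q : (fun q : Fin n → ℚ => dyadicAddress r (ratPoint q)) ⁻¹' {m},
          μ {ratPoint q.1} :=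
        ENNReal.tsum_le_tsum fun m => hpreimage m ▸ hμ.le_tsum (dyadicCube r m)
    _ = ∑' q : Fin n → ℚ, μ {ratPoint q} :=
        ENNReal.tsum_fiberwise (fun q : Fin n → ℚ => μ {ratPoint q}) _

/-- The least corner of the `r`-dyadic cube with address `m`. -/
def dyadicCorner (r : ℕ) (m : Fin n → ℤ) : Fin n → ℚ := fun i => mkRat (m i) (2 ^ r)

theorem dyadicAddress_dyadicCorner (r : ℕ) (m : Fin n → ℤ) :
    dyadicAddress r (ratPoint (dyadicCorner r m)) = m := by
  funext i
  simp [dyadicAddress, ratPoint, dyadicCorner, Rat.mkRat_eq_div]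

theorem primrec_pointString_dyadicCorner :
    Primrec₂ fun (r : ℕ) (m : Fin n → ℤ) => pointString (dyadicCorner r m) :=
  primrec_binaryString.comp <| Primrec.fin_curry.2 <|
    primrec_ratCode_mkRat.comp
      (Primrec.fin_app.comp (Primrec.snd.comp Primrec.fst) Primrec.snd)
      (primrec_nat_pow.comp (Primrec.const 2) (Primrec.fst.comp Primrec.fst))

theorem ratPoint_mem_dyadicCube_iff {r : ℕ} {m : Fin n → ℤ} {q : Fin n → ℚ} :
    ratPoint q ∈ dyadicCube r m ↔ ∀ i,
      m i * ((q i).den : ℤ) ≤ (q i).num * ((2 ^ r : ℕ) : ℤ) ∧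
        (q i).num * ((2 ^ r : ℕ) : ℤ) < (m i + 1) * ((q i).den : ℤ) := by
  refine forall_congr' fun i => ?_
  have hden : (0 : ℝ) < (q i).den := by exact_mod_cast (q i).den_pos
  have hcoord : ratPoint q i = ((q i).num : ℝ) / (q i).den := Rat.cast_def (q i)
  rw [hcoord, div_le_div_iff₀ (by positivity) hden, div_lt_div_iff₀ hden (by positivity),
    ← Int.cast_le (R := ℝ), ← Int.cast_lt (R := ℝ)]
  push_cast
  rfl

theorem primrecPred_mem_dyadicCube : PrimrecPred fun p : (Fin n → ℤ × ℕ) × ℕ × (Fin n → ℤ) =>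
    ratPoint (fracPoint p.1) ∈ dyadicCube p.2.1 p.2.2 := by
  refine PrimrecPred.of_eq (primrecPred_forall_fin fun i => ?_)
    fun p => ratPoint_mem_dyadicCube_iff.symm
  have hcode : Primrec fun p : (Fin n → ℤ × ℕ) × ℕ × (Fin n → ℤ) =>
      pointCode (fracPoint p.1) i :=
    Primrec.fin_app.comp (primrec_pointCode_fracPoint.comp Primrec.fst) (Primrec.const i)
  have hm : Primrec fun p : (Fin n → ℤ × ℕ) × ℕ × (Fin n → ℤ) => p.2.2 i :=
    Primrec.fin_app.comp (Primrec.snd.comp Primrec.snd) (Primrec.const i)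
  have hden := primrec_int_natCast.comp (Primrec.snd.comp hcode)
  have hnum := primrec_int_mul.comp (Primrec.fst.comp hcode) (primrec_int_natCast.comp
    (primrec_nat_pow.comp (Primrec.const 2) (Primrec.fst.comp Primrec.snd)))
  exact PrimrecPred.and (primrec_int_le.comp (primrec_int_mul.comp hm hden) hnum)
    (primrec_int_lt.comp hnum (primrec_int_mul.comp (primrec_int_succ.comp hm) hden))

/-! ### The complexity of heavy dyadic cubes -/

theorem FinitelySupported.exists_finset_lt {μ : OuterMeasure (EuclideanSpace ℝ (Fin n))}
    (hμ : FinitelySupported μ) {E : Set (EuclideanSpace ℝ (Fin n))} {c : ℝ≥0∞} (h : c < μ E) :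
    ∃ A : Finset (Fin n → ℚ), (∀ q ∈ A, ratPoint q ∈ E) ∧
      c < μ (ratPoint '' (A : Set (Fin n → ℚ))) := by
  classical
  obtain ⟨A, hA⟩ := hμ (μ E - c) (tsub_pos_of_lt h)
  refine ⟨A.filter fun q => ratPoint q ∈ E, fun q hq => (Finset.mem_filter.1 hq).2, ?_⟩
  set B := A.filter fun q => ratPoint q ∈ E
  have hcover : E ⊆ ratPoint '' (B : Set (Fin n → ℚ)) ∪ (ratPoint '' (A : Set (Fin n → ℚ)))ᶜ := by
    intro x hx
    by_cases hxA : x ∈ ratPoint '' (A : Set (Fin n → ℚ))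
    · obtain ⟨q, hq, rfl⟩ := hxA
      exact Or.inl ⟨q, Finset.mem_filter.2 ⟨hq, hx⟩, rfl⟩
    · exact Or.inr hxA
  by_contra! hle
  refine lt_irrefl (μ E) ?_
  calc μ E ≤ μ (ratPoint '' (B : Set (Fin n → ℚ))) + μ (ratPoint '' (A : Set (Fin n → ℚ)))ᶜ :=
        (measure_mono hcover).trans (measure_union_le _ _)
    _ ≤ c + μ (ratPoint '' (A : Set (Fin n → ℚ)))ᶜ := by gcongr
    _ < c + (μ E - c) := ENNReal.add_lt_add_left h.ne_top hA
    _ = μ E := add_tsub_cancel_of_le h.le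

theorem inv_two_pow_lt_iff_ratCode (v : ℚ≥0) (s : ℕ) :
    (2⁻¹ : ℝ≥0∞) ^ s < ((v : ℝ≥0) : ℝ≥0∞) ↔
      ((ratCode (v : ℚ)).2 : ℤ) < (ratCode (v : ℚ)).1 * ((2 ^ s : ℕ) : ℤ) := by
  have hpow : (2⁻¹ : ℝ≥0∞) ^ s = ((2⁻¹ ^ s : ℝ≥0) : ℝ≥0∞) := by
    rw [ENNReal.coe_pow, ENNReal.coe_inv two_ne_zero, ENNReal.coe_ofNat]
  have hden : (0 : ℝ) < (v : ℚ).den := by exact_mod_cast (v : ℚ).den_pos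
  have hv : ((v : ℝ≥0) : ℝ) = ((v : ℚ).num : ℝ) / (v : ℚ).den := by
    rw [← Rat.cast_def, Rat.cast_nnratCast]
    rfl
  rw [hpow, ENNReal.coe_lt_coe, ← NNReal.coe_lt_coe, hv, lt_div_iff₀ hden, NNReal.coe_pow,
    NNReal.coe_inv, NNReal.coe_ofNat, inv_pow, inv_mul_lt_iff₀ (by positivity), mul_comm]
  simp only [ratCode]
  norm_cast

theorem ComputableApprox.computablePred_inv_two_pow_lt {f : Finset (Fin n → ℚ) → ℕ → ℚ≥0}
    (hf : ComputableApprox f) :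
    ComputablePred fun p : (List (Fin n → ℤ × ℕ) × ℕ) × ℕ =>
      (2⁻¹ : ℝ≥0∞) ^ p.2 < ((f (p.1.1.map fracPoint).toFinset p.1.2 : ℝ≥0) : ℝ≥0∞) := by
  obtain ⟨F, hF, hFf⟩ := hf
  have hmap : Primrec fun p : (List (Fin n → ℤ × ℕ) × ℕ) × ℕ =>
      p.1.1.map fun c => pointCode (fracPoint c) :=
    Primrec.list_map (Primrec.fst.comp Primrec.fst) (primrec_pointCode_fracPoint.comp Primrec.snd)
  have hvalue : Computable fun p : (List (Fin n → ℤ × ℕ) × ℕ) × ℕ =>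
      F (p.1.1.map fun c => pointCode (fracPoint c)) p.1.2 :=
    hF.comp hmap.to_comp (Computable.snd.comp Computable.fst)
  have hlt : PrimrecRel fun (v : ℤ × ℕ) (s : ℕ) => (v.2 : ℤ) < v.1 * ((2 ^ s : ℕ) : ℤ) :=
    primrec_int_lt.comp (primrec_int_natCast.comp (Primrec.snd.comp Primrec.fst))
      (primrec_int_mul.comp (Primrec.fst.comp Primrec.fst) (primrec_int_natCast.comp
        (primrec_nat_pow.comp (Primrec.const 2) Primrec.snd)))
  refine ComputablePred.of_eq
    ⟨inferInstance, hlt.decide.to_comp.comp hvalue Computable.snd⟩ fun p => ?_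
  rw [inv_two_pow_lt_iff_ratCode, ← hFf, List.map_map, Function.comp_def]

theorem FinitelySupported.lt_measure_iff_exists_stage
    {μ : OuterMeasure (EuclideanSpace ℝ (Fin n))} (hμ : FinitelySupported μ)
    {f : Finset (Fin n → ℚ) → ℕ → ℚ≥0}
    (hf_le : ∀ A t, ((f A t : ℝ≥0) : ℝ≥0∞) ≤ μ (ratPoint '' (A : Set (Fin n → ℚ))))
    (hf_tendsto : ∀ A : Finset (Fin n → ℚ), Tendsto (fun t => ((f A t : ℝ≥0) : ℝ≥0∞)) atTop
      (𝓝 (μ (ratPoint '' (A : Set (Fin n → ℚ))))))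
    {E : Set (EuclideanSpace ℝ (Fin n))} {c : ℝ≥0∞} :
    c < μ E ↔ ∃ p : List (Fin n → ℤ × ℕ) × ℕ, (∀ a ∈ p.1, ratPoint (fracPoint a) ∈ E) ∧
      c < ((f (p.1.map fracPoint).toFinset p.2 : ℝ≥0) : ℝ≥0∞) := by
  constructor
  · intro h
    obtain ⟨A, hAE, hA⟩ := hμ.exists_finset_lt h
    obtain ⟨t, ht⟩ := ((tendsto_order.1 (hf_tendsto A)).1 _ hA).exists
    refine ⟨(A.toList.map pointCode, t), ?_, ?_⟩
    · simpa [fracPoint_pointCode] using hAE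
    · simpa [Function.comp_def, fracPoint_pointCode] using ht
  · rintro ⟨⟨L, t⟩, hL, ht⟩
    refine ht.trans_le ((hf_le _ t).trans (measure_mono ?_))
    rintro _ ⟨q, hq, rfl⟩
    obtain ⟨a, ha, rfl⟩ := List.mem_map.1 (List.mem_toFinset.1 hq)
    exact hL a ha

theorem computablePred_comp {α β : Type*} [Primcodable α] [Primcodable β] {p : β → Prop}
    (hp : ComputablePred p) {f : α → β} (hf : Computable f) : ComputablePred fun a => p (f a) := by
  obtain ⟨_, hp⟩ := hp
  exact ⟨inferInstance, hp.comp hf⟩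

theorem computablePred_and {α : Type*} [Primcodable α] {p q : α → Prop} (hp : ComputablePred p)
    (hq : ComputablePred q) : ComputablePred fun a => p a ∧ q a := by
  obtain ⟨_, hp⟩ := hp
  obtain ⟨_, hq⟩ := hq
  exact ⟨inferInstance, (Primrec.and.to_comp.comp hp hq).of_eq fun a => (Bool.decide_and _ _).symm⟩

theorem LowerSemicomputable.rePred_lt_measure_dyadicCube
    {μ : OuterMeasure (EuclideanSpace ℝ (Fin n))} (hμ : LowerSemicomputable μ) :
    REPred fun p : (ℕ × ℕ) × (Fin n → ℤ) =>
      (2⁻¹ : ℝ≥0∞) ^ p.1.2 < μ (dyadicCube p.1.1 p.2) := by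
  obtain ⟨hfs, f, hf, hf_le, hf_tendsto⟩ := hμ
  refine REPred.of_eq (rePred_exists (computablePred_and ?_ ?_)) fun p =>
    (hfs.lt_measure_iff_exists_stage (fun A t => (hf_le A t t le_rfl).2) hf_tendsto).symm
  · have hinside : PrimrecRel fun (c : Fin n → ℤ × ℕ) (a : ℕ × (Fin n → ℤ)) =>
        ratPoint (fracPoint c) ∈ dyadicCube a.1 a.2 := primrecPred_mem_dyadicCube
    exact PrimrecPred.computablePred <| hinside.forall_mem_list.comp
      (Primrec.fst.comp Primrec.snd) (Primrec.pair (Primrec.fst.comp (Primrec.fst.comp Primrec.fst))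
        (Primrec.snd.comp Primrec.fst))
  · exact computablePred_comp hf.computablePred_inv_two_pow_lt (Computable.pair Computable.snd
      (Computable.snd.comp (Computable.fst.comp Computable.fst)))

theorem exists_pointComplexity_dyadicCorner_le {U : List Bool →. List Bool}
    (hU : IsUniversalPrefixMachine U) {μ : OuterMeasure (EuclideanSpace ℝ (Fin n))}
    (hfinite : StronglyFinite μ) (hlsc : LowerSemicomputable μ) :
    ∃ C : ℕ, ∀ (r s : ℕ) (m : Fin n → ℤ), (2⁻¹ : ℝ≥0∞) ^ s < μ (dyadicCube r m) →
      pointComplexity U (dyadicCorner r m) ≤ s + 2 * (Nat.pair r s).size + C := by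
  obtain ⟨w, hw⟩ : ∃ w : ℕ, ∑' q : Fin n → ℚ, μ {ratPoint q} ≤ 2 ^ w := by
    obtain ⟨k, hk⟩ := ENNReal.exists_nat_gt hfinite.2.ne
    exact ⟨k, hk.le.trans (by exact_mod_cast Nat.lt_two_pow_self.le)⟩
  have hcard : ∀ p : ℕ × ℕ, {m : Fin n → ℤ | (2⁻¹ : ℝ≥0∞) ^ p.2 < μ (dyadicCube p.1 m)}.encard ≤
      (2 ^ (p.2 + w) : ℕ) := fun p => by
    have hle := (hfinite.encard_heavyCubes_mul_le p.1 (2⁻¹ ^ p.2)).trans hw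
    generalize {m : Fin n → ℤ | (2⁻¹ : ℝ≥0∞) ^ p.2 < μ (dyadicCube p.1 m)}.encard = N at hle ⊢
    rw [← ENNReal.inv_pow, ← div_eq_mul_inv, ENNReal.div_le_iff (by simp) (by simp), ← pow_add,
      add_comm w] at hle
    exact_mod_cast hle
  obtain ⟨C, hC⟩ := exists_complexity_le_of_rePred hU
    (P := fun (p : ℕ × ℕ) (m : Fin n → ℤ) => (2⁻¹ : ℝ≥0∞) ^ p.2 < μ (dyadicCube p.1 m))
    hlsc.rePred_lt_measure_dyadicCube
    (Primrec.nat_add.comp Primrec.snd (Primrec.const w)) hcard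
    (out := fun p => pointString (dyadicCorner p.1.1 p.2))
    (primrec_pointString_dyadicCorner.comp (Primrec.fst.comp Primrec.fst) Primrec.snd).to_comp
  refine ⟨w + C, fun r s m hm => (hC (r, s) m hm).trans_eq ?_⟩
  rw [length_binaryString, Encodable.encode_prod_val, Encodable.encode_nat, Encodable.encode_nat]
  ring

/-! ### Logarithms and binary sizes -/

theorem negLogTwo_antitone : Antitone negLogTwo := fun a b hab =>
  EReal.div_le_div_right_of_nonneg (by exact_mod_cast (Real.log_pos one_lt_two).le)
    (ENNReal.log_monotone (ENNReal.inv_le_inv.2 hab))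

theorem negLogTwo_ofReal {c : ℝ} (hc : 0 < c) :
    negLogTwo (ENNReal.ofReal c) = ((-Real.logb 2 c : ℝ) : EReal) := by
  rw [negLogTwo, ENNReal.log_inv, ENNReal.log_ofReal_of_pos hc, ← EReal.coe_neg, ← EReal.coe_div,
    Real.logb, neg_div]

theorem inv_two_pow_lt_of_negLogTwo_lt {a : ℝ≥0∞} {s : ℕ} (h : negLogTwo a < ((s : ℝ) : EReal)) :
    2⁻¹ ^ s < a := by
  contrapose! h
  have hpow : (2⁻¹ : ℝ≥0∞) ^ s = ENNReal.ofReal ((2 ^ s)⁻¹) := by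
    rw [ENNReal.ofReal_inv_of_pos (by positivity), ENNReal.ofReal_pow two_pos.le,
      ENNReal.ofReal_ofNat, ENNReal.inv_pow]
  have hlog : -Real.logb 2 ((2 : ℝ) ^ s)⁻¹ = s := by
    rw [Real.logb_inv, neg_neg, Real.logb_pow, Real.logb_self_eq_one one_lt_two, mul_one]
  calc ((s : ℝ) : EReal) = negLogTwo (2⁻¹ ^ s) := by
        rw [hpow, negLogTwo_ofReal (by positivity), hlog]
    _ ≤ negLogTwo a := negLogTwo_antitone h

theorem exists_le_negLogTwo {b : ℝ≥0∞} (hb : b ≠ ∞) :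
    ∃ w : ℝ, ∀ a ≤ b, (w : EReal) ≤ negLogTwo a := by
  refine ⟨-Real.logb 2 (b.toReal + 1), fun a hab => ?_⟩
  rw [← negLogTwo_ofReal (by positivity)]
  refine negLogTwo_antitone (hab.trans ?_)
  exact (ENNReal.le_ofReal_iff_toReal_le hb (by positivity)).2 (by linarith)

theorem exists_size_le_mul_add {ε : ℝ} (hε : 0 < ε) :
    ∃ C : ℝ, ∀ m : ℕ, (m.size : ℝ) ≤ ε * m + C := by
  have hexp := tendsto_pow_const_div_const_pow_of_one_lt 1 (one_lt_two (α := ℝ))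
  obtain ⟨K, hK⟩ := eventually_atTop.1 (hexp.eventually_lt_const (half_pos hε))
  refine ⟨K + 1, fun m => ?_⟩
  rcases le_or_gt m.size K with hsmall | hlarge
  · have hsize : (m.size : ℝ) ≤ K := by exact_mod_cast hsmall
    linarith [show 0 ≤ ε * m by positivity]
  · obtain ⟨j, hj⟩ := Nat.exists_eq_succ_of_ne_zero (Nat.ne_zero_of_lt hlarge)
    have hpow : (2 : ℝ) ^ j ≤ m := by
      exact_mod_cast Nat.lt_size.1 (hj ▸ Nat.lt_succ_self j)
    have hlt := hK m.size hlarge.le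
    rw [pow_one, div_lt_iff₀ (by positivity), hj, pow_succ, ← hj] at hlt
    have hscaled := mul_le_mul_of_nonneg_left hpow hε.le
    linarith [show (0 : ℝ) ≤ K by positivity]

theorem size_pair_le (r s : ℕ) : (Nat.pair r s).size ≤ 2 * (r + s + 1).size := by
  rw [Nat.size_le]
  calc Nat.pair r s < (max r s + 1) ^ 2 := Nat.pair_lt_max_add_one_sq r s
    _ ≤ (r + s + 1) ^ 2 := by gcongr; omega
    _ ≤ (2 ^ (r + s + 1).size) ^ 2 := by gcongr; exact (Nat.lt_size_self _).le
    _ = 2 ^ (2 * (r + s + 1).size) := by rw [← pow_mul, mul_comm]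

theorem exists_size_pair_le_mul_add {ε : ℝ} (hε : 0 < ε) :
    ∃ C : ℝ, ∀ r s : ℕ, ((Nat.pair r s).size : ℝ) ≤ ε * (r + s) + C := by
  obtain ⟨C, hC⟩ := exists_size_le_mul_add (half_pos hε)
  refine ⟨ε + 2 * C, fun r s => ?_⟩
  have hpair : ((Nat.pair r s).size : ℝ) ≤ 2 * (r + s + 1).size := by
    exact_mod_cast size_pair_le r s
  have hsize := hC (r + s + 1)
  push_cast at hsize
  linarith

/-! ### Comparison of growth rates -/

/-- The sequences satisfy `a r ≤ (1 + o(1)) * b (r + k) + o(r)`. The values of `b` enter only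
through their real upper bounds `t`, since they may be infinite. -/
def GrowthLE (k : ℕ) (a b : ℕ → EReal) : Prop :=
  ∀ ε : ℝ, 0 < ε → ∃ C : ℝ, ∀ᶠ r : ℕ in atTop, ∀ t : ℝ, b (r + k) < t →
    a r ≤ (((1 + ε) * t + ε * r + C : ℝ) : EReal)

section GrowthLE

variable {k : ℕ} {a b : ℕ → EReal}

theorem GrowthLE.eventually_div_le (h : GrowthLE k a b) {y z : ℝ} (hyz : y < z) :
    ∀ᶠ r : ℕ in atTop, b (r + k) / (((r + k : ℕ) : ℝ) : EReal) < y →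
      a r / ((r : ℝ) : EReal) ≤ z := by
  obtain ⟨ε, hεz, hε⟩ : ∃ ε : ℝ, (1 + ε) * y + ε < z ∧ 0 < ε := by
    have hlim : Tendsto (fun ε : ℝ => (1 + ε) * y + ε) (𝓝[>] 0) (𝓝 y) := by
      have hcontinuous : Continuous fun ε : ℝ => (1 + ε) * y + ε := by fun_prop
      simpa using (hcontinuous.tendsto 0).mono_left nhdsWithin_le_nhds
    exact ((hlim.eventually_lt_const hyz).and self_mem_nhdsWithin).exists
  obtain ⟨C, hC⟩ := h ε hε
  have hlarge := (tendsto_natCast_atTop_atTop.const_mul_atTop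
    (sub_pos.2 hεz)).eventually_ge_atTop ((1 + ε) * (y * k) + C)
  filter_upwards [hC, hlarge, eventually_gt_atTop 0] with r hr hlarge hr0 hb
  have hrpos : (0 : ℝ) < r := by exact_mod_cast hr0
  have hrk : (0 : ℝ) < ((r + k : ℕ) : ℝ) := by exact_mod_cast Nat.add_pos_left hr0 k
  rw [EReal.div_lt_iff (by exact_mod_cast hrk) (EReal.coe_ne_top _), ← EReal.coe_mul] at hb
  rw [EReal.div_le_iff_le_mul (by exact_mod_cast hrpos) (EReal.coe_ne_top _), ← EReal.coe_mul]
  refine (hr _ hb).trans (EReal.coe_le_coe_iff.2 ?_)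
  push_cast
  linarith

theorem GrowthLE.liminf_div_le (h : GrowthLE k a b) :
    liminf (fun r : ℕ => a r / ((r : ℝ) : EReal)) atTop ≤
      liminf (fun r : ℕ => b r / ((r : ℝ) : EReal)) atTop := by
  rw [← EReal.le_of_forall_lt_iff_le]
  intro z hz
  obtain ⟨y, hy, hyz⟩ := EReal.lt_iff_exists_real_btwn.1 hz
  rw [← liminf_nat_add _ k] at hy
  have hfreq := frequently_lt_of_liminf_lt (by isBoundedDefault) hy
  refine liminf_le_of_frequently_le ?_ (by isBoundedDefault)
  exact (hfreq.and_eventually (h.eventually_div_le (EReal.coe_lt_coe_iff.1 hyz))).mono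
    fun r hr => hr.2 hr.1

theorem GrowthLE.limsup_div_le (h : GrowthLE k a b) :
    limsup (fun r : ℕ => a r / ((r : ℝ) : EReal)) atTop ≤
      limsup (fun r : ℕ => b r / ((r : ℝ) : EReal)) atTop := by
  rw [← EReal.le_of_forall_lt_iff_le]
  intro z hz
  obtain ⟨y, hy, hyz⟩ := EReal.lt_iff_exists_real_btwn.1 hz
  rw [← limsup_nat_add _ k] at hy
  refine limsup_le_of_le (by isBoundedDefault) ?_
  filter_upwards [eventually_lt_of_limsup_lt hy (by isBoundedDefault),
    h.eventually_div_le (EReal.coe_lt_coe_iff.1 hyz)] with r hb hr using hr hb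

end GrowthLE

/-! ### Complexity at a given precision and the measure of balls -/

variable {U : List Bool →. List Bool} {μ : OuterMeasure (EuclideanSpace ℝ (Fin n))}
  {x : EuclideanSpace ℝ (Fin n)} {r : ℕ}

theorem complexityAt_le {q : Fin n → ℚ} (h : dist (ratPoint q) x < ((2 : ℝ) ^ r)⁻¹) :
    complexityAt U r x ≤ pointComplexity U q :=
  Nat.sInf_le ⟨q, h, rfl⟩

theorem exists_pointComplexity_eq_complexityAt (U : List Bool →. List Bool) (r : ℕ)
    (x : EuclideanSpace ℝ (Fin n)) : ∃ q : Fin n → ℚ, dist (ratPoint q) x < ((2 : ℝ) ^ r)⁻¹ ∧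
      pointComplexity U q = complexityAt U r x := by
  obtain ⟨q, hq, h⟩ := Nat.sInf_mem
    (s := {k | ∃ q : Fin n → ℚ, dist (ratPoint q) x < ((2 : ℝ) ^ r)⁻¹ ∧ k = pointComplexity U q})
    ⟨_, dyadicCorner (r + n) (dyadicAddress (r + n) x),
      dist_lt_of_dyadicAddress_eq (dyadicAddress_dyadicCorner _ _), rfl⟩
  exact ⟨q, hq, h.symm⟩

theorem dyadicCube_subset_ball {q : EuclideanSpace ℝ (Fin n)}
    (h : dist q x < ((2 : ℝ) ^ (r + 1))⁻¹) :
    dyadicCube (r + 1 + n) (dyadicAddress (r + 1 + n) q) ⊆ Metric.ball x ((2 : ℝ) ^ r)⁻¹ := by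
  intro y hy
  have hyq : dist y q < ((2 : ℝ) ^ (r + 1))⁻¹ :=
    dist_lt_of_dyadicAddress_eq (mem_dyadicCube_iff.1 hy)
  calc dist y x ≤ dist y q + dist q x := dist_triangle y q x
    _ < ((2 : ℝ) ^ (r + 1))⁻¹ + ((2 : ℝ) ^ (r + 1))⁻¹ := add_lt_add hyq h
    _ = ((2 : ℝ) ^ r)⁻¹ := by rw [pow_succ]; field_simp; norm_num

theorem exists_dyadicCube_inv_two_pow_le_programMeasure (hU : IsUniversalPrefixMachine U) (r : ℕ)
    (x : EuclideanSpace ℝ (Fin n)) :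
    ∃ m, dyadicCube (r + 1 + n) m ⊆ Metric.ball x ((2 : ℝ) ^ r)⁻¹ ∧
      2⁻¹ ^ complexityAt U (r + 1) x ≤ programMeasure U n (dyadicCube (r + 1 + n) m) := by
  obtain ⟨q, hq, hcomplexity⟩ := exists_pointComplexity_eq_complexityAt U (r + 1) x
  obtain ⟨π, hπ, hlength⟩ := exists_program hU (pointString q)
  refine ⟨_, dyadicCube_subset_ball hq, ?_⟩
  calc 2⁻¹ ^ complexityAt U (r + 1) x = programWeight π := by
        rw [← hcomplexity, pointComplexity, ← hlength, programWeight]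
    _ ≤ _ := programWeight_le_programMeasure ⟨q, hπ, mem_dyadicCube_iff.2 rfl⟩

theorem DominatesOnDyadicCubes.growthLE_negLogTwo_measure_ball (hU : IsUniversalPrefixMachine U)
    (hμ : DominatesOnDyadicCubes μ (programMeasure U n)) (x : EuclideanSpace ℝ (Fin n)) :
    GrowthLE 1 (fun r => negLogTwo (μ (Metric.ball x ((2 : ℝ) ^ r)⁻¹)))
      fun r => ((complexityAt U r x : ℝ) : EReal) := by
  intro ε hε
  obtain ⟨β, hβ, hβo, hdom⟩ := hμ
  refine ⟨ε * (1 + n), ?_⟩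
  filter_upwards [(tendsto_add_atTop_nat (1 + n)).eventually (hβo.bound hε)] with r hr t ht
  obtain ⟨m, hball, hcube⟩ := exists_dyadicCube_inv_two_pow_le_programMeasure hU r x
  set K := complexityAt U (r + 1) x
  have hmass : ENNReal.ofReal (β (r + 1 + n) * 2⁻¹ ^ K) ≤ μ (Metric.ball x ((2 : ℝ) ^ r)⁻¹) :=
    calc ENNReal.ofReal (β (r + 1 + n) * 2⁻¹ ^ K) = ENNReal.ofReal (β (r + 1 + n)) * 2⁻¹ ^ K := by
          rw [ENNReal.ofReal_mul (hβ _).le, ENNReal.ofReal_pow (by positivity),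
            ENNReal.ofReal_inv_of_pos two_pos, ENNReal.ofReal_ofNat]
      _ ≤ ENNReal.ofReal (β (r + 1 + n)) * programMeasure U n (dyadicCube (r + 1 + n) m) := by
          gcongr
      _ ≤ μ (dyadicCube (r + 1 + n) m) := hdom _ _ ⟨m, rfl⟩
      _ ≤ μ (Metric.ball x ((2 : ℝ) ^ r)⁻¹) := measure_mono hball
  refine (negLogTwo_antitone hmass).trans ?_
  rw [negLogTwo_ofReal (mul_pos (hβ _) (by positivity)), EReal.coe_le_coe_iff,
    Real.logb_mul (hβ _).ne' (by positivity), Real.logb_pow, Real.logb_inv,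
    Real.logb_self_eq_one one_lt_two]
  rw [← add_assoc, Real.norm_eq_abs, Real.norm_of_nonneg (by positivity)] at hr
  have hKt : (K : ℝ) < t := EReal.coe_lt_coe_iff.1 ht
  have ht0 : 0 < ε * t := mul_pos hε ((Nat.cast_nonneg K).trans_lt hKt)
  have hlog := neg_le_abs (Real.logb 2 (β (r + 1 + n)))
  push_cast at hr
  linarith

theorem dist_dyadicCorner_lt {m : Fin n → ℤ} {y : EuclideanSpace ℝ (Fin n)}
    (hm : y ∈ dyadicCube (r + 1 + n) m) (hx : dist y x < ((2 : ℝ) ^ (r + 1 + n))⁻¹) :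
    dist (ratPoint (dyadicCorner (r + 1 + n) m)) x < ((2 : ℝ) ^ r)⁻¹ := by
  refine dyadicCube_subset_ball (hx.trans_le ?_) (mem_dyadicCube_iff.2 ?_)
  · exact inv_anti₀ (by positivity) (pow_le_pow_right₀ one_le_two (Nat.le_add_right _ n))
  · rw [dyadicAddress_dyadicCorner, mem_dyadicCube_iff.1 hm]

theorem three_pow_mul_inv_two_pow_le (n s : ℕ) :
    3 ^ n * (2⁻¹ : ℝ≥0∞) ^ (s + 2 * n) ≤ 2⁻¹ ^ s := by
  have hle : (3 : ℝ≥0∞) * 2⁻¹ ^ 2 ≤ 1 := by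
    rw [← ENNReal.inv_pow, ← div_eq_mul_inv]
    exact ENNReal.div_le_of_le_mul (by norm_num)
  calc 3 ^ n * (2⁻¹ : ℝ≥0∞) ^ (s + 2 * n) = (3 * 2⁻¹ ^ 2) ^ n * 2⁻¹ ^ s := by
        rw [pow_add, pow_mul, mul_pow]
        ring
    _ ≤ 1 ^ n * 2⁻¹ ^ s := by gcongr
    _ = 2⁻¹ ^ s := by rw [one_pow, one_mul]

theorem exists_complexityAt_le (hU : IsUniversalPrefixMachine U) (hfinite : StronglyFinite μ)
    (hlsc : LowerSemicomputable μ) :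
    ∃ C : ℕ, ∀ (x : EuclideanSpace ℝ (Fin n)) (r s : ℕ),
      2⁻¹ ^ s < μ (Metric.ball x ((2 : ℝ) ^ (r + 1 + n))⁻¹) →
        complexityAt U r x ≤ s + 2 * n + 2 * (Nat.pair (r + 1 + n) (s + 2 * n)).size + C := by
  obtain ⟨C, hC⟩ := exists_pointComplexity_dyadicCorner_le hU hfinite hlsc
  refine ⟨C, fun x r s h => ?_⟩
  obtain ⟨m, hm⟩ :=
    exists_lt_measure_dyadicCube_inter_ball ((three_pow_mul_inv_two_pow_le n s).trans_lt h)
  obtain ⟨y, hycube, hyball⟩ : (dyadicCube (r + 1 + n) m ∩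
      Metric.ball x ((2 : ℝ) ^ (r + 1 + n))⁻¹).Nonempty := by
    contrapose! hm
    rw [hm, measure_empty]
    exact zero_le
  exact (complexityAt_le (dist_dyadicCorner_lt hycube hyball)).trans
    (hC _ _ m (hm.trans_le (measure_mono Set.inter_subset_left)))

theorem growthLE_complexityAt (hU : IsUniversalPrefixMachine U) (hfinite : StronglyFinite μ)
    (hlsc : LowerSemicomputable μ) (x : EuclideanSpace ℝ (Fin n)) :
    GrowthLE (1 + n) (fun r => ((complexityAt U r x : ℝ) : EReal))
      fun r => negLogTwo (μ (Metric.ball x ((2 : ℝ) ^ r)⁻¹)) := by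
  intro ε hε
  obtain ⟨C, hC⟩ := exists_complexityAt_le hU hfinite hlsc
  obtain ⟨D, hD⟩ := exists_size_pair_le_mul_add (half_pos hε)
  obtain ⟨w, hw⟩ := exists_le_negLogTwo (hfinite.lt_top Set.univ).ne
  refine ⟨(1 + ε) * (|w| + 1 + 2 * n) + ε * (1 + n) + 2 * D + C,
    Eventually.of_forall fun r t ht => EReal.coe_le_coe_iff.2 ?_⟩
  have hwt : w < t := EReal.coe_lt_coe_iff.1 ((hw _ (measure_mono (Set.subset_univ _))).trans_lt ht)
  have hceil : (⌈t⌉₊ : ℝ) ≤ t + |w| + 1 := by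
    have hlt := Nat.ceil_lt_add_one (a := t + |w|) (by linarith [neg_abs_le w])
    have hmono : (⌈t⌉₊ : ℝ) ≤ ⌈t + |w|⌉₊ := by
      exact_mod_cast Nat.ceil_mono (by linarith [abs_nonneg w])
    linarith
  have hmass := inv_two_pow_lt_of_negLogTwo_lt
    (ht.trans_le (EReal.coe_le_coe_iff.2 (Nat.le_ceil t)))
  rw [← add_assoc] at hmass
  have hcomplexity : (complexityAt U r x : ℝ) ≤
      ⌈t⌉₊ + 2 * n + 2 * (Nat.pair (r + 1 + n) (⌈t⌉₊ + 2 * n)).size + C := by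
    exact_mod_cast hC x r _ hmass
  have hsize := hD (r + 1 + n) (⌈t⌉₊ + 2 * n)
  push_cast at hsize
  have hscaled := mul_le_mul_of_nonneg_left hceil (by positivity : 0 ≤ 1 + ε)
  linarith

end AlgDim

end

theorem mainTheorem1 {n : ℕ} (U : List Bool →. List Bool)
    (hU : AlgDim.IsUniversalPrefixMachine U)
    (μ : MeasureTheory.OuterMeasure (EuclideanSpace ℝ (Fin n)))
    (hμ : AlgDim.LocallyOptimal μ) (x : EuclideanSpace ℝ (Fin n)) :
    AlgDim.lowerLocalDim μ x = AlgDim.algDim U x ∧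
      AlgDim.upperLocalDim μ x = AlgDim.strongAlgDim U x := by
  have hdom : AlgDim.DominatesOnDyadicCubes μ (AlgDim.programMeasure U n) :=
    hμ.dominates _ (AlgDim.stronglyFinite_programMeasure hU.isPrefixMachine)
      (AlgDim.lowerSemicomputable_programMeasure hU.isPrefixMachine)
  have hle := hdom.growthLE_negLogTwo_measure_ball hU x
  have hge := AlgDim.growthLE_complexityAt hU hμ.stronglyFinite hμ.lowerSemicomputable x
  simp only [AlgDim.lowerLocalDim, AlgDim.upperLocalDim, AlgDim.algDim, AlgDim.strongAlgDim,
    EReal.coe_div]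
  exact ⟨le_antisymm hle.liminf_div_le hge.liminf_div_le,
    le_antisymm hle.limsup_div_le hge.limsup_div_le⟩
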